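/- **Model.** The base stations (BSs) are the points of a homogeneous Poisson point process on $\mathbb R^2$ of density $\lambda_c>0$; each BS $y$ is the centre of a cluster and serves users whose positions $y+x$ have relative displacements $x$ that are independent of the BSs, with the same distribution in every cluster. Consider one user per cluster (for instance the nearest user or a randomly chosen other user; the law of its displacement $x$ is arbitrary). A BS at distance $r$ has path loss $L_p(r)=C_Lr^{-\alpha_L}$ if $r\le R_L$ (LOS) and $L_p(r)=C_Nr^{-\alpha_N}$ if $r>R_L$ (NLOS), where $R_L,C_L,C_N,\alpha_L>0$ and $\alpha_N>2$. The link from an interfering BS at distance $r$ to the user contributes the power $M|g|^2G_F(\theta)L_p(r)$, where $|g|$ is Nakagami with shape parameter $N_L>0$ (LOS) or $N_N>0$ (NLOS) and $\mathbb E|g|^2=1$, $\theta$ is uniform on $[-q/\lambda,q/\lambda]$ with $q,\lambda>0$, $M\ge 1$ is the number of antenna elements and $$G_F(\theta)=\frac{\sin^2(\pi M\theta)}{M^2\sin^2(\pi\theta)}$$ (equal to $1$ at integers) is the normalized Fejér kernel. The fading and angle variables of different links are independent, and independent of each other and of all positions. The inter-cluster interference $I$ at the user is the sum of these contributions over all BSs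 except the BS of its own cluster. Let $\mathcal L_I(s)=\mathbb E[e^{-sI}]$ be its Laplace transform at the user of the typical (uniformly chosen) cluster, i.e. for any Borel window $W$ with $0<|W|<\infty$, the expected sum of $e^{-sI}$ over the clusters with centre in $W$, divided by the expected number of such clusters. **Claim.** For every $s>0$, $$\mathcal L_I(s)=\lim_{n_1\to\infty}\exp\Bigl(-\frac{\pi^2\lambda_cR_L^2}{2n_1}\sum_{i=1}^{n_1}\mathcal G_F^I\Bigl(s,\frac{\zeta_iq}{\lambda}\Bigr)\sqrt{1-\zeta_i^2}\Bigr),\qquad \zeta_i=\cos\Bigl(\frac{2i-1}{2n_1}\pi\Bigr),$$ where $$\mathcal G_F^I(s,g)=\rho_N\Bigl(\frac{sMC_NG_F(g)}{N_NR_L^{\alpha_N}}\Bigr)-\rho_L\Bigl(\frac{N_LR_L^{\alpha_L}}{sMG_F(g)C_L}\Bigr)$$ (extended by continuity, by the value $0$, to the $g$ with $G_F(g)=0$), $$\rho_L(v)=\frac{2v^{N_L}}{\alpha_LN_L+2}\;{}_2F_1\Bigl(N_L,N_L+\tfrac2{\alpha_L};N_L+\tfrac2{\alpha_L}+1;-v\Bigr),\qquad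 \rho_N(v)={}_2F_1\Bigl(-\tfrac2{\alpha_N},N_N;1-\tfrac2{\alpha_N};-v\Bigr),$$ and ${}_2F_1$ is the Gauss hypergeometric function, continued holomorphically to $\mathbb C\setminus[1,\infty)$. -/

import Mathlib

open MeasureTheory ProbabilityTheory Filter Topology
open scoped ENNReal NNReal

noncomputable section

namespace MmWave

/-! ### The Gauss hypergeometric function on the plane cut along `[1, ∞)` -/

/-- The complex plane cut along the real half-line `[1, ∞)`. -/
def cutPlane : Set ℂ := {z | 1 - z ∈ Complex.slitPlane}

/-- `f` is the holomorphic continuation to the cut plane of the Gauss series `₂F₁(a, b; c; z)`,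
`‖z‖ < 1` (Mathlib's `₂F₁` is the sum of this series, with a junk value where it diverges). -/
def IsGaussContinuation (a b c : ℂ) (f : ℂ → ℂ) : Prop :=
  DifferentiableOn ℂ f cutPlane ∧ Set.EqOn f (₂F₁ a b c) (Metric.ball 0 1)

open Classical in
/-- The Gauss hypergeometric function `₂F₁(a, b; c; z)` for `z` in the cut plane: the value at `z`
of the holomorphic continuation of the Gauss series. -/
def gaussF (a b c z : ℂ) : ℂ :=
  if h : ∃ f, IsGaussContinuation a b c f then h.choose z else 0

lemma isOpen_cutPlane : IsOpen cutPlane :=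
  Complex.isOpen_slitPlane.preimage (continuous_const.sub continuous_id)

lemma isPreconnected_cutPlane : IsPreconnected cutPlane := by
  have h : cutPlane = (fun w : ℂ => 1 - w) '' Complex.slitPlane := by
    ext z
    constructor
    · intro hz
      exact ⟨1 - z, hz, by simp⟩
    · rintro ⟨w, hw, rfl⟩
      simpa [cutPlane] using hw
  rw [h]
  have hc : IsPreconnected Complex.slitPlane :=
    (Complex.starConvex_one_slitPlane.isPathConnected
      Complex.one_mem_slitPlane).isConnected.isPreconnected
  exact hc.image _ (by fun_prop)

/-- The continuation is unique, so `gaussF` is well defined. -/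
lemma gaussF_eq {a b c : ℂ} {f : ℂ → ℂ} (hf : IsGaussContinuation a b c f) {z : ℂ}
    (hz : z ∈ cutPlane) : gaussF a b c z = f z := by
  have h : ∃ f, IsGaussContinuation a b c f := ⟨f, hf⟩
  have h1 := h.choose_spec
  rw [gaussF, dif_pos h]
  refine (h1.1.analyticOnNhd isOpen_cutPlane).eqOn_of_preconnected_of_eventuallyEq
    (hf.1.analyticOnNhd isOpen_cutPlane) isPreconnected_cutPlane (z₀ := 0) (by simp [cutPlane]) ?_ hz
  filter_upwards [Metric.ball_mem_nhds (0 : ℂ) one_pos] with w hw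
  rw [h1.2 hw, hf.2 hw]

/-! ### Parameters, path loss and antenna gain -/

/-- The numerical parameters of the network. -/
structure Params where
  /-- density `λ_c` of the base stations -/
  dens : ℝ
  /-- radius `R_L` of the LOS disc -/
  RL : ℝ
  /-- path loss intercepts `C_L`, `C_N` -/
  CL : ℝ
  CN : ℝ
  /-- path loss exponents `α_L`, `α_N` -/
  αL : ℝ
  αN : ℝ
  /-- Nakagami fading parameters `N_L`, `N_N` -/
  NL : ℝ
  NN : ℝ
  /-- number of antenna elements `M` -/
  M : ℕ
  /-- antenna spacing `q` -/
  q : ℝ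
  /-- wavelength `λ` -/
  wl : ℝ

/-- LOS-disc path loss at distance `r`: a link is LOS exactly when `r ≤ R_L`. -/
def pathLoss (p : Params) (r : ℝ) : ℝ :=
  if r ≤ p.RL then p.CL * r ^ (-p.αL) else p.CN * r ^ (-p.αN)

open Classical in
/-- The Fejér kernel with `M` elements, normalized to have maximum `1`:
`sin² (π M g) / (M² sin² (π g))`, extended by continuity (by `1`) to the integers. -/
def fejer (M : ℕ) (g : ℝ) : ℝ :=
  if Real.sin (Real.pi * g) = 0 then 1
  else Real.sin (Real.pi * M * g) ^ 2 / ((M : ℝ) ^ 2 * Real.sin (Real.pi * g) ^ 2)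

/-- The Nakagami distribution with shape parameter `m` and unit mean power, i.e. with density
`2 m ^ m / Γ(m) * x ^ (2 m - 1) * exp (- m x²)` on `(0, ∞)`. -/
def nakagami (m : ℝ) : Measure ℝ :=
  (volume.restrict (Set.Ioi 0)).withDensity fun x =>
    ENNReal.ofReal (2 * m ^ m / Real.Gamma m * x ^ (2 * m - 1) * Real.exp (-(m * x ^ 2)))

/-- The uniform distribution of the angle difference on `[-q/λ, q/λ]`. -/
def angleLaw (p : Params) : Measure ℝ :=
  ProbabilityTheory.cond volume (Set.Icc (-(p.q / p.wl)) (p.q / p.wl))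

/-! ### The network -/

/-- The plane. -/
abbrev Plane : Type := EuclideanSpace ℝ (Fin 2)

variable {Ω : Type*} [MeasurableSpace Ω]

/-- Number of points of the point process `{Y 0, Y 1, …}` in the set `B`. -/
def count (Y : ℕ → Ω → Plane) (B : Set Plane) (ω : Ω) : ℝ≥0∞ :=
  ∑' n, B.indicator 1 (Y n ω)

/-- `Y 0, Y 1, …` is an enumeration, by random points, of a homogeneous Poisson point process of
density `d` on the plane: the number of points in a Borel set of finite area `A` has the Poisson
distribution with mean `d * A`, and the numbers of points in disjoint Borel sets are
independent. -/
structure IsHomogeneousPPP (P : Measure Ω) (d : ℝ) (Y : ℕ → Ω → Plane) : Prop where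
  measurable : ∀ n, Measurable (Y n)
  law_count : ∀ B : Set Plane, MeasurableSet B → volume B ≠ ∞ →
    HasLaw (count Y B)
      ((poissonMeasure (d * (volume B).toReal).toNNReal).map (Nat.cast : ℕ → ℝ≥0∞)) P
  indep_count : ∀ (k : ℕ) (B : Fin k → Set Plane), (∀ i, MeasurableSet (B i)) →
    Pairwise (Function.onFun Disjoint B) → iIndepFun (fun i => count Y (B i)) P

/-- The probabilistic model. `Y n` is the BS (centre) of cluster `n`; `X n` is the position,
relative to `Y n`, of the considered user of cluster `n` (the near user or the far user, say),
whose law `ν` is the same in all clusters.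
For the link to that user from the BS `m`: `gL n m`, `gN n m` are the fading amplitudes that
apply if the link is LOS, respectively NLOS, and `θ n m` is the angle difference between the beam
of BS `m` and the user.
The BSs form a homogeneous PPP; the user positions are independent of the BSs; the link variables
have the stated laws, are independent of each other, and are independent of all positions. -/
structure IsNetwork (p : Params) (P : Measure Ω) (ν : Measure Plane)
    (Y X : ℕ → Ω → Plane) (gL gN θ : ℕ → ℕ → Ω → ℝ) : Prop where
  ppp : IsHomogeneousPPP P p.dens Y
  measurable_user : ∀ n, Measurable (X n)
  law_user : ∀ n, P.map (X n) = ν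
  measurable_gL : ∀ n m, Measurable (gL n m)
  measurable_gN : ∀ n m, Measurable (gN n m)
  measurable_θ : ∀ n m, Measurable (θ n m)
  law_link : ∀ n m, P.map (fun ω => (gL n m ω, gN n m ω, θ n m ω)) =
    (nakagami p.NL).prod ((nakagami p.NN).prod (angleLaw p))
  indep_link : iIndepFun
    (fun (l : ℕ × ℕ) ω => (gL l.1 l.2 ω, gN l.1 l.2 ω, θ l.1 l.2 ω)) P
  indep_user : IndepFun (fun ω n => Y n ω) (fun ω n => X n ω) P
  indep_position_link : IndepFun (fun ω n => (Y n ω, X n ω))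
    (fun ω (l : ℕ × ℕ) => (gL l.1 l.2 ω, gN l.1 l.2 ω, θ l.1 l.2 ω)) P

/-- Distance between the user of cluster `n` and the BS `m`. -/
def linkDist (Y X : ℕ → Ω → Plane) (n m : ℕ) (ω : Ω) : ℝ :=
  ‖X n ω + (Y n ω - Y m ω)‖

/-- Effective channel gain `|hᴴ w|² = M |g|² G_F(θ)` from the BS `m` to the user of cluster `n`;
`|g|` is the LOS or the NLOS fading amplitude, according to the state of the link. -/
def channelGain (p : Params) (Y X : ℕ → Ω → Plane) (gL gN θ : ℕ → ℕ → Ω → ℝ)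
    (n m : ℕ) (ω : Ω) : ℝ :=
  p.M * (if linkDist Y X n m ω ≤ p.RL then gL n m ω else gN n m ω) ^ 2 * fejer p.M (θ n m ω)

/-- Inter-cluster interference at the user of cluster `n`: the sum over all BSs except its own. -/
def interference (p : Params) (Y X : ℕ → Ω → Plane) (gL gN θ : ℕ → ℕ → Ω → ℝ)
    (n : ℕ) (ω : Ω) : ℝ≥0∞ :=
  ∑' m, if m = n then 0 else
    ENNReal.ofReal (channelGain p Y X gL gN θ n m ω * pathLoss p (linkDist Y X n m ω))

open Classical in
/-- `exp (-s x)` for `s > 0` and `x ∈ [0, ∞]`, with `exp (-∞) = 0`. -/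
def expNeg (s : ℝ) (x : ℝ≥0∞) : ℝ≥0∞ :=
  if x = ∞ then 0 else ENNReal.ofReal (Real.exp (-(s * x.toReal)))

/-- Laplace transform at `s` of the inter-cluster interference at the typical user, that is, at
the user of a typical (randomly chosen) cluster, in the sense of Palm: the mean of
`exp (-s I)` summed over the clusters with centre in the window `W`, divided by the mean number of
such clusters. -/
def laplaceInterference (p : Params) (P : Measure Ω) (Y X : ℕ → Ω → Plane)
    (gL gN θ : ℕ → ℕ → Ω → ℝ) (W : Set Plane) (s : ℝ) : ℝ :=
  ((∫⁻ ω, ∑' n, W.indicator 1 (Y n ω) * expNeg s (interference p Y X gL gN θ n ω) ∂P) /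
    (∫⁻ ω, count Y W ω ∂P)).toReal

/-! ### The closed form -/

/-- The function `ρ_L`. -/
def rhoL (p : Params) (v : ℝ) : ℝ :=
  (gaussF (p.NL : ℂ) ((p.NL + 2 / p.αL : ℝ) : ℂ) ((p.NL + 2 / p.αL + 1 : ℝ) : ℂ)
      ((-v : ℝ) : ℂ)).re * (2 * v ^ p.NL) / (p.αL * p.NL + 2)

/-- The function `ρ_N`. -/
def rhoN (p : Params) (v : ℝ) : ℝ :=
  (gaussF ((-(2 / p.αN) : ℝ) : ℂ) (p.NN : ℂ) ((1 - 2 / p.αN : ℝ) : ℂ) ((-v : ℝ) : ℂ)).re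

open Classical in
/-- The function `G_F^I(s, g)`. At the zeros of the antenna gain `G_F`, where the argument of
`ρ_L` is infinite, it is extended by continuity, by the value `0`
(`ρ_N(0) = 1` and `ρ_L(v) → 1` as `v → ∞`). -/
def GFI (p : Params) (s g : ℝ) : ℝ :=
  if fejer p.M g = 0 then 0
  else
    rhoN p (s * p.M * p.CN * fejer p.M g / (p.NN * p.RL ^ p.αN)) -
      rhoL p (p.NL * p.RL ^ p.αL / (s * p.M * fejer p.M g * p.CL))

/-- The `i`-th of the `n` Gauss–Chebyshev nodes, `1 ≤ i ≤ n`. -/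
def node (n i : ℕ) : ℝ := Real.cos ((2 * (i : ℝ) - 1) / (2 * (n : ℝ)) * Real.pi)

/-- The closed-form expression with `n` Gauss–Chebyshev nodes. -/
def closedForm (p : Params) (s : ℝ) (n : ℕ) : ℝ :=
  Real.exp (-(Real.pi ^ 2 * p.dens * p.RL ^ 2 / (2 * (n : ℝ))) *
    ∑ i ∈ Finset.Icc 1 n, GFI p s (node n i * p.q / p.wl) * √(1 - node n i ^ 2))

end MmWave

end

/-!
The proof has a probabilistic and an analytic half.

**Probability.** Given all positions, the links of one user are independent, so that the average of
`exp (-s I)` over fading and angles is a product over the interfering base stations of factors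
`linkLaplace`, each the Laplace transform of the power of one link of the given length
(`IsNetwork.lintegral_expNeg_interference`). It remains to average the functional
`∑_{y ∈ W} exp (-∑_{z ≠ y} k (y - z))` over the Poisson process. The law of the counts gives the
Laplace functional (`IsHomogeneousPPP.laplace`). Its derivative in the direction of an indicator is
the Palm formula for `∑_y w (y) exp (-∑_{z ≠ y} u (z))` (`IsHomogeneousPPP.palm_negExp`), and one
more derivative is the second factorial moment measure (`IsHomogeneousPPP.lintegral_pairs`).
The Palm formula does not yet allow `u` to depend on `y`. For `u (z) = k (y - z)`, cut `W` into
small cells and replace `y` by a fixed point of its cell: the error is controlled by the second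
moment measure and by the continuity of translation in `L¹`, which gives
`IsHomogeneousPPP.mecke_translate`. By translation invariance the displacement of the user
disappears, and the Laplace transform is `exp (-λ_c ∫ (1 - linkLaplace ‖z‖) dz)`
(`IsNetwork.laplaceInterference_eq`). Differentiation is done by monotone convergence, along the
difference quotients `expQuot`.

**Analysis.** A Nakagami power is Gamma distributed, so that `linkLaplace` is the average over the
angle of `(1 + a L_p(r) / N) ^ (-N)`, with `a = s M G_F(θ)`. In polar coordinates, the substitutions
`r = R_L x ^ (1 / α_L)` for `r ≤ R_L` and `r = R_L x ^ (-1 / α_N)` for `r > R_L` turn the integral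
into integrals over `(0, 1)` (`radialIntegral_eq`). These are Euler integrals, which also give the
holomorphic continuation of the hypergeometric series to the cut plane
(`isGaussContinuation_euler`, `isGaussContinuation_euler_neg`). So `GFI` is the radial integral, a
continuous function of the angle (`GFI_eq`, `continuous_GFI`), and its average over the angle is the
limit of the Gauss–Chebyshev sums, which are midpoint Riemann sums in the variable `t` for
`x = cos t` (`tendsto_gaussChebyshev`).
-/

noncomputable section

namespace MmWave

/-! ### The decreasing exponential on `[0, ∞]` -/

/-- The function `x ↦ exp (-x)` on `[0, ∞]`, with `exp (-∞) = 0`. -/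
def negExp (x : ℝ≥0∞) : ℝ≥0∞ := EReal.exp (-(x : EReal))

@[simp] lemma negExp_zero : negExp 0 = 1 := by simp [negExp]

@[simp] lemma negExp_top : negExp ∞ = 0 := by simp [negExp]

lemma negExp_ofReal {x : ℝ} (hx : 0 ≤ x) :
    negExp (ENNReal.ofReal x) = ENNReal.ofReal (Real.exp (-x)) := by
  rw [negExp, EReal.coe_ennreal_ofReal, max_eq_left hx, ← EReal.coe_neg, EReal.exp_coe]

lemma negExp_add (x y : ℝ≥0∞) : negExp (x + y) = negExp x * negExp y := by
  rw [negExp, negExp, negExp, ← EReal.exp_add, EReal.coe_ennreal_add, EReal.neg_add, sub_eq_add_neg]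
  · simp
  · simp

lemma negExp_antitone : Antitone negExp := fun x y h => by
  unfold negExp
  simpa using h

lemma negExp_le_one (x : ℝ≥0∞) : negExp x ≤ 1 := by
  simpa using negExp_antitone (zero_le (a := x))

lemma negExp_ne_top (x : ℝ≥0∞) : negExp x ≠ ∞ :=
  ne_top_of_le_ne_top ENNReal.one_ne_top (negExp_le_one x)

lemma negExp_ne_zero {x : ℝ≥0∞} (hx : x ≠ ∞) : negExp x ≠ 0 := by
  simpa [negExp] using hx

lemma continuous_negExp : Continuous negExp :=
  ENNReal.continuous_exp.comp (continuous_neg.comp continuous_coe_ennreal_ereal)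

@[fun_prop]
lemma measurable_negExp : Measurable negExp := continuous_negExp.measurable

lemma negExp_sum {ι : Type*} (S : Finset ι) (f : ι → ℝ≥0∞) :
    negExp (∑ i ∈ S, f i) = ∏ i ∈ S, negExp (f i) := by
  classical
  induction S using Finset.induction_on with
  | empty => simp
  | insert a S ha ih => rw [Finset.sum_insert ha, Finset.prod_insert ha, negExp_add, ih]

lemma expNeg_eq_negExp {s : ℝ} (hs : 0 < s) (x : ℝ≥0∞) :
    expNeg s x = negExp (ENNReal.ofReal s * x) := by
  unfold expNeg
  split_ifs with h
  · subst h
    rw [ENNReal.mul_top (by simpa using hs), negExp_top]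
  · rw [← ENNReal.ofReal_toReal h, ← ENNReal.ofReal_mul hs.le, negExp_ofReal (by positivity),
      ENNReal.toReal_ofReal ENNReal.toReal_nonneg]

lemma one_sub_negExp_le (x : ℝ≥0∞) : 1 - negExp x ≤ x := by
  induction x using ENNReal.recTopCoe with
  | top => simp
  | coe x =>
    rw [← ENNReal.ofReal_coe_nnreal (p := x), negExp_ofReal x.coe_nonneg, ← ENNReal.ofReal_one,
      ← ENNReal.ofReal_sub _ (Real.exp_pos _).le]
    apply ENNReal.ofReal_le_ofReal
    linarith [Real.add_one_le_exp (-(x : ℝ))]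

/-- The difference quotient `(1 - exp (-t x)) / t` for `t = 2 ^ (-k)`, which increases to `x`
as `k` grows. -/
def expQuot (k : ℕ) (x : ℝ≥0∞) : ℝ≥0∞ := 2 ^ k * (1 - negExp (x / 2 ^ k))

lemma expQuot_le (k : ℕ) (x : ℝ≥0∞) : expQuot k x ≤ x := by
  calc expQuot k x ≤ 2 ^ k * (x / 2 ^ k) := by
        unfold expQuot
        gcongr
        exact one_sub_negExp_le _
    _ = x := ENNReal.mul_div_cancel (by simp) (by simp)

lemma mul_expQuot_one_div (k : ℕ) (c : ℝ≥0∞) :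
    c * expQuot k 1 / 2 ^ k = c * (1 - negExp (1 / 2 ^ k)) := by
  rw [expQuot, mul_left_comm, mul_div_assoc, ENNReal.mul_div_cancel (by simp) (by simp)]

lemma expQuot_mono_right (k : ℕ) : Monotone (expQuot k) := fun x y h => by
  unfold expQuot
  gcongr
  exact negExp_antitone (by gcongr)

@[fun_prop]
lemma measurable_expQuot (k : ℕ) : Measurable (expQuot k) := by
  unfold expQuot
  fun_prop

/-- With `y = exp (-x / 2 ^ (k + 1))`, this is `1 - y ^ 2 = (1 - y) (1 + y) ≤ 2 (1 - y)`. -/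
lemma expQuot_le_succ (k : ℕ) (x : ℝ≥0∞) : expQuot k x ≤ expQuot (k + 1) x := by
  unfold expQuot
  have hx : x / 2 ^ k = x / 2 ^ (k + 1) + x / 2 ^ (k + 1) := by
    rw [← two_mul, div_eq_mul_inv, div_eq_mul_inv, pow_succ,
      ENNReal.mul_inv (by simp) (by simp), mul_comm ((2 : ℝ≥0∞) ^ k)⁻¹, mul_left_comm x,
      ← mul_assoc, ENNReal.mul_inv_cancel (by simp) (by simp), one_mul]
  rw [hx, negExp_add, pow_succ, mul_assoc]
  gcongr
  have hy := negExp_le_one (x / (2 ^ k * 2))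
  have hy' := negExp_ne_top (x / (2 ^ k * 2))
  generalize negExp (x / (2 ^ k * 2)) = y at hy hy'
  lift y to ℝ≥0 using hy'
  norm_cast at hy ⊢
  rw [tsub_le_iff_right]
  have h2 : (y : ℝ) ≤ 1 := by exact_mod_cast hy
  have : (1 : ℝ) ≤ 2 * (1 - y) + y * y := by nlinarith [sq_nonneg (1 - (y : ℝ))]
  rw [← NNReal.coe_le_coe]
  push_cast [NNReal.coe_sub hy]
  exact this

lemma expQuot_mono_left (x : ℝ≥0∞) : Monotone fun k => expQuot k x :=
  monotone_nat_of_le_succ fun k => expQuot_le_succ k x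

lemma tendsto_expQuot (x : ℝ≥0∞) : Tendsto (fun k => expQuot k x) atTop (𝓝 x) := by
  induction x using ENNReal.recTopCoe with
  | top =>
    have : (fun k => expQuot k ∞) = fun k => (2 : ℝ≥0∞) ^ k := by
      ext k
      simp [expQuot, ENNReal.top_div]
    rw [this]
    exact ENNReal.tendsto_pow_atTop_nhds_top_iff.2 (by norm_num)
  | coe x =>
    have key : ∀ k : ℕ, expQuot k x =
        ENNReal.ofReal ((2 : ℝ) ^ k * (1 - Real.exp (-(x / 2 ^ k)))) := by
      intro k
      have h2 : (2 : ℝ≥0∞) ^ k = ENNReal.ofReal (2 ^ k) := by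
        rw [ENNReal.ofReal_pow (by norm_num)]; simp
      rw [expQuot, h2, ← ENNReal.ofReal_coe_nnreal, ← ENNReal.ofReal_div_of_pos (by positivity),
        negExp_ofReal (by positivity), ← ENNReal.ofReal_one,
        ← ENNReal.ofReal_sub _ (Real.exp_pos _).le, ← ENNReal.ofReal_mul (by positivity)]
    simp_rw [key]
    rw [← ENNReal.ofReal_coe_nnreal]
    apply ENNReal.tendsto_ofReal
    have hd : HasDerivAt (fun t : ℝ => 1 - Real.exp (-(x * t))) x 0 := by
      have h := (((hasDerivAt_id (0 : ℝ)).const_mul (x : ℝ)).neg.exp).const_sub 1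
      simpa using h
    have ht : Tendsto (fun k : ℕ => ((1 : ℝ) / 2) ^ k) atTop (𝓝[≠] 0) := by
      rw [tendsto_nhdsWithin_iff]
      exact ⟨tendsto_pow_atTop_nhds_zero_of_lt_one (by norm_num) (by norm_num),
        Eventually.of_forall fun k => by simp⟩
    refine (hd.tendsto_slope_zero.comp ht).congr fun k => ?_
    simp [div_eq_mul_inv]

/-- The difference quotient survives the substitution `t ↦ 1 - exp (-t)` for the step. -/
lemma tendsto_expQuot_mul_expQuot_one (c : ℝ≥0∞) :
    Tendsto (fun k => expQuot k (c * expQuot k 1)) atTop (𝓝 c) := by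
  have hmono : Monotone fun k => expQuot k (c * expQuot k 1) := fun j k h =>
    (expQuot_mono_left _ h).trans (expQuot_mono_right k (by gcongr; exact expQuot_mono_left 1 h))
  have hsup : ∀ x, ⨆ k, expQuot k x = x := fun x =>
    tendsto_nhds_unique (tendsto_atTop_iSup (expQuot_mono_left x)) (tendsto_expQuot x)
  have : ⨆ k, expQuot k (c * expQuot k 1) = c := by
    apply le_antisymm
    · refine iSup_le fun k => (expQuot_le k _).trans ?_
      calc c * expQuot k 1 ≤ c * 1 := by gcongr; exact expQuot_le k 1
        _ = c := mul_one c
    · calc c = c * ⨆ j, expQuot j 1 := by rw [hsup, mul_one]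
        _ = ⨆ j, ⨆ k, expQuot k (c * expQuot j 1) := by simp_rw [ENNReal.mul_iSup, hsup]
        _ ≤ _ := iSup_le fun j => iSup_le fun k => by
          refine le_trans ?_ (le_iSup _ (max j k))
          refine (expQuot_mono_left _ (le_max_right j k)).trans (expQuot_mono_right _ ?_)
          gcongr
          exact expQuot_mono_left 1 (le_max_left j k)
  simpa [this] using tendsto_atTop_iSup hmono

/-! ### The Laplace functional of a Poisson point process -/

/-- The sum of `u` over the points of the process `{Y 0, Y 1, …}`. -/
def pointSum {Ω : Type*} (Y : ℕ → Ω → Plane) (u : Plane → ℝ≥0∞) (ω : Ω) : ℝ≥0∞ :=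
  ∑' m, u (Y m ω)

section

variable {Ω : Type*} [MeasurableSpace Ω] {P : Measure Ω} {d : ℝ} {Y : ℕ → Ω → Plane}

lemma measurable_pointSum (hY : ∀ n, Measurable (Y n)) {u : Plane → ℝ≥0∞} (hu : Measurable u) :
    Measurable (pointSum Y u) :=
  Measurable.tsum fun n => hu.comp (hY n)

lemma measurable_count (hY : ∀ n, Measurable (Y n)) {B : Set Plane} (hB : MeasurableSet B) :
    Measurable (count Y B) :=
  measurable_pointSum hY (measurable_one.indicator hB)

/-- The Laplace transform of the Poisson distribution. -/
lemma lintegral_negExp_poissonMeasure (r a : ℝ≥0) :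
    ∫⁻ n : ℕ, negExp (a * n) ∂poissonMeasure r = negExp (r * (1 - negExp a)) := by
  have h1 : ∀ n : ℕ, negExp ((a : ℝ≥0∞) * n) = ENNReal.ofReal (Real.exp (-a) ^ n) := by
    intro n
    have : (a : ℝ≥0∞) * n = ENNReal.ofReal (a * n) := by
      rw [ENNReal.ofReal_mul a.coe_nonneg]; simp
    rw [this, negExp_ofReal (by positivity), ← Real.exp_nat_mul]
    ring_nf
  have h2 : (r : ℝ≥0∞) * (1 - negExp a) = ENNReal.ofReal (r * (1 - Real.exp (-a))) := by
    rw [ENNReal.ofReal_mul r.coe_nonneg, ← ENNReal.ofReal_coe_nnreal (p := a),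
      negExp_ofReal a.coe_nonneg,
      ENNReal.ofReal_sub _ (Real.exp_pos _).le]
    simp
  have h3 : Real.exp (-a) ≤ 1 := by simp
  rw [h2, negExp_ofReal (mul_nonneg r.coe_nonneg (by linarith)), poissonMeasure,
    lintegral_sum_measure]
  simp_rw [lintegral_smul_measure, lintegral_dirac, h1, smul_eq_mul]
  have h4 : ∀ n : ℕ, ENNReal.ofReal (Real.exp (-r) * r ^ n / n.factorial) *
      ENNReal.ofReal (Real.exp (-a) ^ n) =
      ENNReal.ofReal (Real.exp (-r) * ((r * Real.exp (-a)) ^ n / n.factorial)) := by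
    intro n
    rw [← ENNReal.ofReal_mul (by positivity)]
    congr 1
    rw [mul_pow]
    ring
  simp_rw [h4]
  have hs := (NormedSpace.expSeries_div_hasSum_exp ((r : ℝ) * Real.exp (-a))).mul_left
    (Real.exp (-r))
  rw [← ENNReal.ofReal_tsum_of_nonneg (fun n => by positivity) hs.summable, hs.tsum_eq,
    ← Real.exp_eq_exp_ℝ, ← Real.exp_add]
  congr 2
  ring

lemma IsHomogeneousPPP.lintegral_negExp_mul_count (h : IsHomogeneousPPP P d Y) (hd : 0 ≤ d)
    {B : Set Plane} (hB : MeasurableSet B) (hB' : volume B ≠ ∞) (a : ℝ≥0) :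
    ∫⁻ ω, negExp (a * count Y B ω) ∂P =
      negExp (ENNReal.ofReal d * ((1 - negExp a) * volume B)) := by
  rw [(h.law_count B hB hB').lintegral_comp (f := fun x => negExp (a * x)) (by fun_prop),
    lintegral_map (by fun_prop) .of_discrete, lintegral_negExp_poissonMeasure]
  congr 1
  rw [mul_comm (1 - negExp a), ← mul_assoc]
  congr 1
  change ENNReal.ofReal _ = _
  rw [ENNReal.ofReal_mul hd, ENNReal.ofReal_toReal hB']

/-- The Laplace functional at a simple function of support of finite area. -/
lemma IsHomogeneousPPP.laplace_simpleFunc (h : IsHomogeneousPPP P d Y) (hd : 0 ≤ d)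
    (u : SimpleFunc Plane ℝ≥0) (hu : ∀ a ≠ 0, volume (u ⁻¹' {a}) ≠ ∞) :
    ∫⁻ ω, negExp (pointSum Y (fun z => u z) ω) ∂P =
      negExp (ENNReal.ofReal d * ∫⁻ z, (1 - negExp (u z))) := by
  classical
  set R : Finset ℝ≥0 := u.range.filter (· ≠ 0)
  have hu_sum : ∀ z, (u z : ℝ≥0∞) = ∑ a ∈ R, (a : ℝ≥0∞) * (u ⁻¹' {a}).indicator 1 z := by
    intro z
    by_cases hz : u z = 0
    · rw [hz, Finset.sum_eq_zero]
      · simp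
      · intro a ha
        have : a ≠ 0 := (Finset.mem_filter.1 ha).2
        simp [Set.indicator, hz, this.symm]
    · rw [Finset.sum_eq_single (u z)]
      · simp
      · intro a _ ha
        simp [Set.indicator, ha.symm]
      · intro hn
        exact absurd (Finset.mem_filter.2 ⟨u.mem_range_self z, hz⟩) hn
  have hsum : ∀ ω, pointSum Y (fun z => u z) ω = ∑ a ∈ R, (a : ℝ≥0∞) * count Y (u ⁻¹' {a}) ω := by
    intro ω
    unfold pointSum count
    simp_rw [hu_sum]
    rw [Summable.tsum_finsetSum fun _ _ => ENNReal.summable]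
    simp_rw [ENNReal.tsum_mul_left]
  have hind : iIndepFun (fun (a : R) => count Y (u ⁻¹' {(a : ℝ≥0)})) P := by
    have h1 := h.indep_count R.card (fun i => u ⁻¹' {((R.equivFin.symm i : R) : ℝ≥0)})
      (fun i => u.measurableSet_fiber _) (by
        intro i j hij
        refine Disjoint.preimage _ (Set.disjoint_singleton.2 fun he => hij ?_)
        exact R.equivFin.symm.injective (Subtype.ext he))
    have h2 := h1.precomp R.equivFin.injective
    simpa using h2
  have hint : ∫⁻ z, (1 - negExp (u z)) = ∑ a ∈ R, (1 - negExp a) * volume (u ⁻¹' {a}) := by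
    have := SimpleFunc.map_lintegral (μ := volume) (fun a : ℝ≥0 => 1 - negExp a) u
    rw [← SimpleFunc.lintegral_eq_lintegral] at this
    simp only [SimpleFunc.map_apply] at this
    rw [this, Finset.sum_filter_of_ne]
    intro a _ ha h0
    simp [h0] at ha
  simp_rw [hsum, negExp_sum, ← Finset.prod_coe_sort R]
  rw [lintegral_prod_eq_prod_lintegral_of_indepFun Finset.univ
    (fun (a : R) ω => negExp ((a : ℝ≥0) * count Y (u ⁻¹' {(a : ℝ≥0)}) ω))]
  · rw [hint, Finset.mul_sum, negExp_sum, ← Finset.prod_coe_sort R]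
    refine Finset.prod_congr rfl fun a _ => ?_
    exact h.lintegral_negExp_mul_count hd (u.measurableSet_fiber _)
      (hu _ (Finset.mem_filter.1 a.2).2) _
  · exact hind.comp (fun a x => negExp ((a : ℝ≥0) * x)) fun a => by fun_prop
  · intro a
    have := measurable_count h.measurable (u.measurableSet_fiber (a : ℝ≥0))
    fun_prop

/-- The Laplace functional of a homogeneous Poisson point process. -/
theorem IsHomogeneousPPP.laplace [IsProbabilityMeasure P] (h : IsHomogeneousPPP P d Y)
    (hd : 0 ≤ d) {u : Plane → ℝ≥0∞} (hu : Measurable u) :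
    ∫⁻ ω, negExp (pointSum Y u ω) ∂P =
      negExp (ENNReal.ofReal d * ∫⁻ z, (1 - negExp (u z))) := by
  classical
  -- Simple functions of bounded support that increase to `u`.
  let v : ℕ → SimpleFunc Plane ℝ≥0 := fun k =>
    ((SimpleFunc.eapprox u k).map ENNReal.toNNReal).restrict (Metric.ball 0 k)
  have hball : ∀ k : ℕ, MeasurableSet (Metric.ball (0 : Plane) k) := fun k =>
    Metric.isOpen_ball.measurableSet
  have hv : ∀ k z, (v k z : ℝ≥0∞) =
      (Metric.ball 0 (k : ℝ)).indicator (SimpleFunc.eapprox u k) z := by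
    intro k z
    simp only [v]
    rw [SimpleFunc.restrict_apply _ (hball k)]
    by_cases hz : z ∈ Metric.ball (0 : Plane) k
    · simp only [Set.indicator_of_mem hz, SimpleFunc.map_apply]
      exact ENNReal.coe_toNNReal (SimpleFunc.eapprox_lt_top u k z).ne
    · simp [Set.indicator_of_notMem hz]
  have hvmono : ∀ z, Monotone fun k => (v k z : ℝ≥0∞) := by
    intro z j k hjk
    simp only [hv]
    refine (Set.indicator_le_indicator_of_subset ?_ (fun _ => zero_le) z).trans
      (Set.indicator_le_indicator (SimpleFunc.monotone_eapprox u hjk z))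
    exact Metric.ball_subset_ball (by exact_mod_cast hjk)
  have hvt : ∀ z, Tendsto (fun k => (v k z : ℝ≥0∞)) atTop (𝓝 (u z)) := by
    intro z
    refine (SimpleFunc.tendsto_eapprox hu z).congr' ?_
    filter_upwards [eventually_gt_atTop ⌈‖z‖⌉₊] with k hk
    rw [hv, Set.indicator_of_mem]
    simpa using Nat.lt_of_ceil_lt hk
  have hfin : ∀ k, ∀ a ≠ 0, volume (v k ⁻¹' {a}) ≠ ∞ := by
    intro k a ha
    refine ne_top_of_le_ne_top (measure_ball_lt_top (x := (0 : Plane)) (r := k)).ne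
      (measure_mono fun z hz => ?_)
    by_contra hz'
    apply ha
    have : v k z = a := hz
    rw [← this, ← ENNReal.coe_inj, hv, Set.indicator_of_notMem hz', ENNReal.coe_zero]
  have hsum : ∀ ω, Tendsto (fun k => pointSum Y (fun z => v k z) ω) atTop (𝓝 (pointSum Y u ω)) := by
    intro ω
    unfold pointSum
    simp_rw [← lintegral_count]
    exact lintegral_tendsto_of_tendsto_of_monotone (fun k => measurable_of_countable _ |>.aemeasurable)
      (ae_of_all _ fun m => hvmono _) (ae_of_all _ fun m => hvt _)
  have hL : Tendsto (fun k => ∫⁻ ω, negExp (pointSum Y (fun z => v k z) ω) ∂P) atTop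
      (𝓝 (∫⁻ ω, negExp (pointSum Y u ω) ∂P)) := by
    refine tendsto_lintegral_of_dominated_convergence (fun _ => 1) (fun k => ?_)
      (fun k => ae_of_all _ fun ω => negExp_le_one _) (by simp)
      (ae_of_all _ fun ω => (continuous_negExp.tendsto _).comp (hsum ω))
    exact measurable_negExp.comp (measurable_pointSum h.measurable (by fun_prop))
  have hR : Tendsto (fun k => negExp (ENNReal.ofReal d * ∫⁻ z, (1 - negExp (v k z)))) atTop
      (𝓝 (negExp (ENNReal.ofReal d * ∫⁻ z, (1 - negExp (u z))))) := by
    refine (continuous_negExp.tendsto _).comp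
      (ENNReal.Tendsto.const_mul ?_ (Or.inr ENNReal.ofReal_ne_top))
    refine lintegral_tendsto_of_tendsto_of_monotone (fun k => by fun_prop)
      (ae_of_all _ fun z j k hjk => ?_) (ae_of_all _ fun z => ?_)
    · exact tsub_le_tsub_left (negExp_antitone (hvmono z hjk)) 1
    · exact ENNReal.Tendsto.sub tendsto_const_nhds
        ((continuous_negExp.tendsto _).comp (hvt z)) (Or.inl ENNReal.one_ne_top)
  refine tendsto_nhds_unique hL (hR.congr fun k => ?_)
  rw [h.laplace_simpleFunc hd (v k) (hfin k)]

end

/-! ### Palm formulas -/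

/-- The sum of `u` over all points of the process `{Y 0, Y 1, …}` except the point `Y n`. -/
def restSum {Ω : Type*} (Y : ℕ → Ω → Plane) (u : Plane → ℝ≥0∞) (n : ℕ) (ω : Ω) : ℝ≥0∞ :=
  ∑' m, if m = n then 0 else u (Y m ω)

lemma pointSum_eq_add_restSum {Ω : Type*} (Y : ℕ → Ω → Plane) (u : Plane → ℝ≥0∞) (n : ℕ) (ω : Ω) :
    pointSum Y u ω = u (Y n ω) + restSum Y u n ω := by
  rw [pointSum, restSum, ENNReal.tsum_eq_add_tsum_ite n]
  congr!

section

variable {Ω : Type*} [MeasurableSpace Ω] {P : Measure Ω} {d : ℝ} {Y : ℕ → Ω → Plane}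

lemma measurable_restSum (hY : ∀ n, Measurable (Y n)) {u : Plane → ℝ≥0∞} (hu : Measurable u)
    (n : ℕ) : Measurable (restSum Y u n) := by
  refine Measurable.tsum fun m => ?_
  split_ifs
  · exact measurable_const
  · exact hu.comp (hY m)

/-- The derivative of the Laplace functional at `u` in the direction of an indicator. -/
lemma IsHomogeneousPPP.lintegral_count_mul_negExp [IsProbabilityMeasure P]
    (h : IsHomogeneousPPP P d Y) (hd : 0 ≤ d) {u : Plane → ℝ≥0∞} (hu : Measurable u)
    {A : Set Plane} (hA : MeasurableSet A) :
    ∫⁻ ω, count Y A ω * negExp (pointSum Y u ω) ∂P =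
      ENNReal.ofReal d * (∫⁻ z in A, negExp (u z)) *
        negExp (ENNReal.ofReal d * ∫⁻ z, (1 - negExp (u z))) := by
  have hcm := measurable_count h.measurable hA
  have hum := measurable_pointSum h.measurable hu
  set c := ENNReal.ofReal d * ∫⁻ z in A, negExp (u z)
  set Φ := negExp (ENNReal.ofReal d * ∫⁻ z, (1 - negExp (u z)))
  have hL : Tendsto (fun k => ∫⁻ ω, expQuot k (count Y A ω) * negExp (pointSum Y u ω) ∂P) atTop
      (𝓝 (∫⁻ ω, count Y A ω * negExp (pointSum Y u ω) ∂P)) := by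
    refine lintegral_tendsto_of_tendsto_of_monotone (fun k => by fun_prop)
      (ae_of_all _ fun ω j k hjk => ?_) (ae_of_all _ fun ω => ?_)
    · exact mul_le_mul_left (expQuot_mono_left _ hjk) _
    · exact ENNReal.Tendsto.mul_const (tendsto_expQuot _) (Or.inr (negExp_ne_top _))
  have hR : Tendsto (fun k => expQuot k (c * expQuot k 1) * Φ) atTop (𝓝 (c * Φ)) :=
    ENNReal.Tendsto.mul_const (tendsto_expQuot_mul_expQuot_one c) (Or.inr (negExp_ne_top _))
  refine tendsto_nhds_unique hL (hR.congr fun k => ?_)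
  set t : ℝ≥0∞ := 1 / 2 ^ k
  -- The Laplace functional at the perturbed function.
  set v : Plane → ℝ≥0∞ := fun z => u z + A.indicator (fun _ => t) z
  have hv : Measurable v := hu.add (measurable_const.indicator hA)
  have hpv : ∀ ω, pointSum Y v ω = pointSum Y u ω + count Y A ω / 2 ^ k := by
    intro ω
    simp only [pointSum, count, v]
    rw [ENNReal.tsum_add, div_eq_mul_inv, ← ENNReal.tsum_mul_right]
    congr 2
    ext m
    simp only [Set.indicator, t]
    split_ifs <;> simp
  have hΦv : negExp (ENNReal.ofReal d * ∫⁻ z, (1 - negExp (v z))) =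
      Φ * negExp (c * (1 - negExp t)) := by
    have h1 : ∀ z, 1 - negExp (v z) =
        (1 - negExp (u z)) + A.indicator (fun z => negExp (u z) * (1 - negExp t)) z := by
      intro z
      by_cases hz : z ∈ A
      · simp only [v, Set.indicator_of_mem hz]
        rw [negExp_add, ENNReal.mul_sub (fun _ _ => negExp_ne_top _), mul_one]
        exact (tsub_add_tsub_cancel (negExp_le_one _)
          (mul_le_of_le_one_right' (negExp_le_one _))).symm
      · simp [v, Set.indicator_of_notMem hz]
    simp_rw [h1]
    rw [lintegral_add_left (by fun_prop), lintegral_indicator hA,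
      lintegral_mul_const _ (by fun_prop), mul_add, negExp_add, ← mul_assoc]
  have h2 : ∀ ω, expQuot k (count Y A ω) * negExp (pointSum Y u ω) =
      2 ^ k * (negExp (pointSum Y u ω) - negExp (pointSum Y v ω)) := by
    intro ω
    rw [expQuot, mul_assoc, ENNReal.sub_mul (fun _ _ => negExp_ne_top _), one_mul, hpv, negExp_add,
      mul_comm (negExp (pointSum Y u ω))]
  simp_rw [h2]
  have hvm := measurable_pointSum h.measurable hv
  have hvle : ∀ ω, negExp (pointSum Y v ω) ≤ negExp (pointSum Y u ω) := fun ω => by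
    rw [hpv]
    exact negExp_antitone le_self_add
  rw [lintegral_const_mul _ (by fun_prop), lintegral_sub (by fun_prop) ?_ (ae_of_all _ hvle),
    h.laplace hd hu, h.laplace hd hv, hΦv, expQuot, mul_assoc]
  · congr 1
    rw [ENNReal.sub_mul (fun _ _ => negExp_ne_top _), one_mul, mul_comm Φ]
    congr 3
    rw [mul_expQuot_one_div]
  · rw [h.laplace hd hv]
    exact negExp_ne_top _

lemma IsHomogeneousPPP.lintegral_pointSum_mul_negExp [IsProbabilityMeasure P]
    (h : IsHomogeneousPPP P d Y) (hd : 0 ≤ d) {u w : Plane → ℝ≥0∞} (hu : Measurable u)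
    (hw : Measurable w) :
    ∫⁻ ω, pointSum Y w ω * negExp (pointSum Y u ω) ∂P =
      ENNReal.ofReal d * (∫⁻ z, w z * negExp (u z)) *
        negExp (ENNReal.ofReal d * ∫⁻ z, (1 - negExp (u z))) := by
  have hum := measurable_pointSum h.measurable hu
  refine Measurable.ennreal_induction (motive := fun w =>
    ∫⁻ ω, pointSum Y w ω * negExp (pointSum Y u ω) ∂P =
      ENNReal.ofReal d * (∫⁻ z, w z * negExp (u z)) *
        negExp (ENNReal.ofReal d * ∫⁻ z, (1 - negExp (u z)))) ?_ ?_ ?_ hw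
  · intro c A hA
    have h1 : ∀ ω, pointSum Y (A.indicator fun _ => c) ω = c * count Y A ω := by
      intro ω
      simp only [pointSum, count]
      rw [← ENNReal.tsum_mul_left]
      congr 1
      ext m
      simp [Set.indicator]
    have h2 : ∀ z, A.indicator (fun _ => c) z * negExp (u z) =
        c * A.indicator (fun z => negExp (u z)) z := by
      intro z
      simp [Set.indicator]
    have hcm := measurable_count h.measurable hA
    simp_rw [h1, h2, mul_assoc]
    rw [lintegral_const_mul _ (by fun_prop), h.lintegral_count_mul_negExp hd hu hA,
      lintegral_const_mul _ ((by fun_prop : Measurable fun z => negExp (u z)).indicator hA),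
      lintegral_indicator hA]
    ring
  · intro f g _ hf hg ihf ihg
    have h1 : ∀ ω, pointSum Y (f + g) ω = pointSum Y f ω + pointSum Y g ω := fun ω =>
      ENNReal.tsum_add
    have hfm := measurable_pointSum h.measurable hf
    simp_rw [h1, Pi.add_apply, add_mul]
    rw [lintegral_add_left (by fun_prop), ihf, ihg, lintegral_add_left (by fun_prop)]
    ring
  · intro f hf hmono ih
    have h1 : ∀ ω, pointSum Y (fun z => ⨆ n, f n z) ω = ⨆ n, pointSum Y (f n) ω := fun ω => by
      unfold pointSum
      simp_rw [← lintegral_count]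
      exact lintegral_iSup (fun n => measurable_of_countable _) fun i j hij m => hmono hij _
    have hfm := fun n => measurable_pointSum h.measurable (hf n)
    simp_rw [h1, ENNReal.iSup_mul]
    rw [lintegral_iSup (fun n => by fun_prop), lintegral_iSup (fun n => by fun_prop)]
    · simp_rw [ih, ENNReal.mul_iSup, ENNReal.iSup_mul]
    · exact fun i j hij z => mul_le_mul_left (hmono hij z) _
    · exact fun i j hij ω => mul_le_mul_left (ENNReal.tsum_le_tsum fun m => hmono hij _) _

/-- The Palm (Slivnyak) formula for functionals of the form `exp (-∑ u)`: seen from one of its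
points, the rest of the process is distributed as the process. -/
lemma IsHomogeneousPPP.palm_negExp [IsProbabilityMeasure P]
    (h : IsHomogeneousPPP P d Y) (hd : 0 ≤ d) {u : Plane → ℝ≥0} (hu : Measurable u)
    {w : Plane → ℝ≥0∞} (hw : Measurable w) :
    ∫⁻ ω, ∑' n, w (Y n ω) * negExp (restSum Y (fun z => u z) n ω) ∂P =
      ENNReal.ofReal d * (∫⁻ z, w z) *
        negExp (ENNReal.ofReal d * ∫⁻ z, (1 - negExp (u z))) := by
  have h0 : ∀ z, negExp (u z) ≠ 0 := fun z => negExp_ne_zero ENNReal.coe_ne_top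
  have h1 : ∀ ω, ∑' n, w (Y n ω) * negExp (restSum Y (fun z => u z) n ω) =
      pointSum Y (fun z => w z * (negExp (u z))⁻¹) ω * negExp (pointSum Y (fun z => u z) ω) := by
    intro ω
    rw [pointSum, ← ENNReal.tsum_mul_right]
    congr 1
    ext n
    rw [pointSum_eq_add_restSum Y _ n, negExp_add, mul_assoc, ← mul_assoc _⁻¹,
      ENNReal.inv_mul_cancel (h0 _) (negExp_ne_top _), one_mul]
  simp_rw [h1]
  rw [h.lintegral_pointSum_mul_negExp hd (by fun_prop) (by fun_prop)]
  congr 4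
  ext z
  rw [mul_assoc, ENNReal.inv_mul_cancel (h0 _) (negExp_ne_top _), mul_one]

/-- The second factorial moment measure on products. -/
lemma IsHomogeneousPPP.lintegral_pairs_prod [IsProbabilityMeasure P]
    (h : IsHomogeneousPPP P d Y) (hd : 0 ≤ d) {A B : Set Plane} (hA : MeasurableSet A)
    (hA' : volume A ≠ ∞) (hB : MeasurableSet B) :
    ∫⁻ ω, ∑' n, A.indicator 1 (Y n ω) * restSum Y (B.indicator 1) n ω ∂P =
      ENNReal.ofReal d * volume A * (ENNReal.ofReal d * volume B) := by
  have hYm := h.measurable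
  have hAm : Measurable (A.indicator (1 : Plane → ℝ≥0∞)) := measurable_one.indicator hA
  have hAY : ∀ n, Measurable fun ω => A.indicator (1 : Plane → ℝ≥0∞) (Y n ω) := fun n =>
    hAm.comp (hYm n)
  have hBm : Measurable (B.indicator (1 : Plane → ℝ≥0∞)) := measurable_one.indicator hB
  have hr := fun n => measurable_restSum hYm hBm n
  have hL : Tendsto (fun k => ∫⁻ ω, ∑' n, A.indicator 1 (Y n ω) *
        expQuot k (restSum Y (B.indicator 1) n ω) ∂P) atTop
      (𝓝 (∫⁻ ω, ∑' n, A.indicator 1 (Y n ω) * restSum Y (B.indicator 1) n ω ∂P)) := by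
    refine lintegral_tendsto_of_tendsto_of_monotone (fun k => ?_)
      (ae_of_all _ fun ω j k hjk => ?_) (ae_of_all _ fun ω => ?_)
    · exact (Measurable.tsum fun n => by fun_prop).aemeasurable
    · exact ENNReal.tsum_le_tsum fun n => mul_le_mul_right (expQuot_mono_left _ hjk) _
    · simp_rw [← lintegral_count]
      refine lintegral_tendsto_of_tendsto_of_monotone
        (fun k => (measurable_of_countable _).aemeasurable)
        (ae_of_all _ fun n j k hjk => ?_) (ae_of_all _ fun n => ?_)
      · exact mul_le_mul_right (expQuot_mono_left _ hjk) _
      · refine ENNReal.Tendsto.const_mul (tendsto_expQuot _) (Or.inr ?_)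
        simp only [Set.indicator]
        split_ifs <;> simp
  have hR := ENNReal.Tendsto.const_mul (a := ENNReal.ofReal d * volume A)
    (tendsto_expQuot_mul_expQuot_one (ENNReal.ofReal d * volume B))
    (Or.inr (ENNReal.mul_ne_top ENNReal.ofReal_ne_top hA'))
  refine tendsto_nhds_unique hL (hR.congr fun k => ?_)
  -- `expQuot` is the difference quotient between the functions `0` and `2 ^ (-k) * 1_B`.
  let t : ℝ≥0 := 1 / 2 ^ k
  have ht : (t : ℝ≥0∞) = 1 / 2 ^ k := by
    simp [t]
  have hum : Measurable (B.indicator fun _ => t) := measurable_const.indicator hB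
  have hcoe : ∀ z, ((B.indicator (fun _ => t) z : ℝ≥0) : ℝ≥0∞) =
      B.indicator 1 z / 2 ^ k := by
    intro z
    simp only [Set.indicator]
    split_ifs <;> simp [ht]
  have hrest : ∀ n ω, restSum Y (fun z => (B.indicator (fun _ => t) z : ℝ≥0)) n ω =
      restSum Y (B.indicator 1) n ω / 2 ^ k := by
    intro n ω
    unfold restSum
    rw [div_eq_mul_inv, ← ENNReal.tsum_mul_right]
    congr 1
    ext m
    split_ifs
    · simp
    · exact (hcoe _).trans (div_eq_mul_inv _ _)
  have hsplit : ∀ ω, ∑' n, A.indicator 1 (Y n ω) * expQuot k (restSum Y (B.indicator 1) n ω) =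
      2 ^ k * (∑' n, (A.indicator 1 (Y n ω) * (1 - negExp (restSum Y
        (fun z => (B.indicator (fun _ => t) z : ℝ≥0)) n ω)))) := by
    intro ω
    rw [← ENNReal.tsum_mul_left]
    congr 1
    ext n
    rw [hrest, expQuot, mul_left_comm]
  have hrm := fun n => measurable_restSum hYm (u := fun z => (B.indicator (fun _ => t) z : ℝ≥0))
    (by fun_prop) n
  have hsum : ∫⁻ ω, ∑' n, (A.indicator 1 (Y n ω) * (1 - negExp (restSum Y
        (fun z => (B.indicator (fun _ => t) z : ℝ≥0)) n ω))) ∂P +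
      ∫⁻ ω, ∑' n, A.indicator 1 (Y n ω) * negExp (restSum Y
        (fun z => (B.indicator (fun _ => t) z : ℝ≥0)) n ω) ∂P = ENNReal.ofReal d * volume A := by
    rw [← lintegral_add_left (Measurable.tsum fun n => by fun_prop)]
    have := h.palm_negExp hd (u := fun _ => 0) measurable_const hAm
    simp only [restSum, ENNReal.coe_zero, ite_self, tsum_zero, negExp_zero, mul_one, tsub_self,
      lintegral_zero, mul_zero, lintegral_indicator_one hA] at this
    rw [← this]
    congr 1
    ext ω
    rw [← ENNReal.tsum_add]
    congr 1
    ext n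
    rw [← mul_add, tsub_add_cancel_of_le (negExp_le_one _), mul_one]
  rw [h.palm_negExp hd hum hAm, lintegral_indicator_one hA] at hsum
  have hint : ∫⁻ z, (1 - negExp (B.indicator (fun _ => t) z : ℝ≥0)) =
      (1 - negExp t) * volume B := by
    rw [← setLIntegral_const, ← lintegral_indicator hB]
    congr 1
    ext z
    simp only [Set.indicator]
    split_ifs <;> simp
  have hfin : ENNReal.ofReal d * volume A *
      negExp (ENNReal.ofReal d * ((1 - negExp t) * volume B)) ≠ ∞ :=
    ENNReal.mul_ne_top (ENNReal.mul_ne_top ENNReal.ofReal_ne_top hA') (negExp_ne_top _)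
  rw [hint] at hsum
  simp_rw [hsplit]
  rw [lintegral_const_mul _ (Measurable.tsum fun n => by fun_prop),
    ENNReal.eq_sub_of_add_eq hfin hsum, expQuot, mul_left_comm,
    ENNReal.mul_sub (fun _ _ => ENNReal.mul_ne_top ENNReal.ofReal_ne_top hA'), mul_one]
  congr 4
  rw [mul_expQuot_one_div, ht]
  ring

/-- The second factorial moment measure of a homogeneous Poisson point process is a multiple of
Lebesgue measure. -/
lemma IsHomogeneousPPP.lintegral_pairs [IsProbabilityMeasure P]
    (h : IsHomogeneousPPP P d Y) (hd : 0 ≤ d) {W : Set Plane} (hW : MeasurableSet W)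
    (hW' : volume W ≠ ∞) {F : Plane → Plane → ℝ≥0∞}
    (hF : Measurable fun q : Plane × Plane => F q.1 q.2) :
    ∫⁻ ω, ∑' n, W.indicator 1 (Y n ω) * restSum Y (F (Y n ω)) n ω ∂P =
      ENNReal.ofReal d * ENNReal.ofReal d * ∫⁻ y in W, ∫⁻ z, F y z := by
  have hYm := h.measurable
  have hpair : ∀ n m, Measurable fun ω => (Y n ω, Y m ω) := fun n m => by fun_prop
  let κ : Measure (Plane × Plane) := Measure.sum fun n => Measure.sum fun m =>
    if m = n then 0 else (P.restrict (Y n ⁻¹' W)).map fun ω => (Y n ω, Y m ω)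
  have hκ : ∀ G : Plane → Plane → ℝ≥0∞, Measurable (fun q : Plane × Plane => G q.1 q.2) →
      ∫⁻ q, G q.1 q.2 ∂κ =
        ∫⁻ ω, ∑' n, W.indicator 1 (Y n ω) * restSum Y (G (Y n ω)) n ω ∂P := by
    intro G hG
    have hGm : ∀ n m, Measurable fun ω => G (Y n ω) (Y m ω) := fun n m => hG.comp (hpair n m)
    have hGr : ∀ n, Measurable fun ω => restSum Y (G (Y n ω)) n ω := fun n => by
      refine Measurable.tsum fun m => ?_
      split_ifs
      · exact measurable_const
      · exact hGm n m
    have hWm : ∀ n, Measurable fun ω => W.indicator (1 : Plane → ℝ≥0∞) (Y n ω) := fun n =>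
      (measurable_one.indicator hW).comp (hYm n)
    rw [lintegral_tsum fun n => by fun_prop]
    simp only [κ, lintegral_sum_measure]
    congr 1
    ext n
    have : ∀ m, ∫⁻ q, G q.1 q.2 ∂(if m = n then 0 else
        (P.restrict (Y n ⁻¹' W)).map fun ω => (Y n ω, Y m ω)) =
        ∫⁻ ω in Y n ⁻¹' W, if m = n then 0 else G (Y n ω) (Y m ω) ∂P := by
      intro m
      split_ifs
      · simp
      · rw [lintegral_map hG (hpair n m)]
    simp_rw [this]
    rw [← lintegral_tsum fun m => by split_ifs <;> fun_prop, ← lintegral_indicator (hYm n hW)]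
    congr 1
    ext ω
    by_cases hω : Y n ω ∈ W
    · rw [Set.indicator_of_mem (show ω ∈ Y n ⁻¹' W from hω), Set.indicator_of_mem hω]
      simp [restSum]
    · rw [Set.indicator_of_notMem (show ω ∉ Y n ⁻¹' W from hω), Set.indicator_of_notMem hω]
      simp
  have : Fact (volume W < ∞) := ⟨hW'.lt_top⟩
  have : IsFiniteMeasure ((ENNReal.ofReal d * ENNReal.ofReal d) • volume.restrict W) :=
    Measure.smul_finite _ (ENNReal.mul_ne_top ENNReal.ofReal_ne_top ENNReal.ofReal_ne_top)
  have hprod : ((ENNReal.ofReal d * ENNReal.ofReal d) • volume.restrict W).prod volume = κ := by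
    refine Measure.prod_eq fun A B hA hB => ?_
    have hm : Measurable fun q : Plane × Plane =>
        A.indicator (1 : Plane → ℝ≥0∞) q.1 * B.indicator (1 : Plane → ℝ≥0∞) q.2 := by
      have h1 : Measurable (A.indicator (1 : Plane → ℝ≥0∞)) := measurable_one.indicator hA
      have h2 : Measurable (B.indicator (1 : Plane → ℝ≥0∞)) := measurable_one.indicator hB
      fun_prop
    have h1 := hκ (fun y z => A.indicator 1 y * B.indicator 1 z) hm
    have h2 : ∀ q : Plane × Plane, A.indicator (1 : Plane → ℝ≥0∞) q.1 * B.indicator 1 q.2 =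
        (A ×ˢ B).indicator 1 q := by
      intro q
      by_cases ha : q.1 ∈ A <;> by_cases hb : q.2 ∈ B <;> simp [Set.indicator, ha, hb]
    simp_rw [h2] at h1
    rw [lintegral_indicator_one (hA.prod hB)] at h1
    rw [h1]
    have h3 : ∀ ω n, W.indicator (1 : Plane → ℝ≥0∞) (Y n ω) *
        restSum Y (fun z => (A.indicator 1 (Y n ω) : ℝ≥0∞) * B.indicator 1 z) n ω =
        (A ∩ W).indicator 1 (Y n ω) * restSum Y (B.indicator 1) n ω := by
      intro ω n
      unfold restSum
      simp_rw [← ENNReal.tsum_mul_left]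
      congr 1
      ext m
      by_cases ha : Y n ω ∈ A <;> by_cases hb : Y n ω ∈ W <;> simp [Set.indicator, ha, hb]
    simp_rw [h3]
    rw [h.lintegral_pairs_prod hd (hA.inter hW)
      (ne_top_of_le_ne_top hW' (measure_mono Set.inter_subset_right)) hB]
    rw [Measure.smul_apply, Measure.restrict_apply hA, smul_eq_mul]
    ring
  rw [← hκ F hF, ← hprod, lintegral_prod _ hF.aemeasurable]
  rw [lintegral_smul_measure, smul_eq_mul]

end

/-! ### The Slivnyak–Mecke formula for translation-invariant pair functionals -/

/-- Translation is continuous in `L¹`. -/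
lemma exists_lintegral_translate_le {f : Plane → ℝ} (hf : Integrable f) {ε : ℝ≥0∞} (hε : ε ≠ 0) :
    ∃ δ > 0, ∀ v : Plane, ‖v‖ < δ → ∫⁻ z, ‖f (z + v) - f z‖ₑ ≤ ε := by
  have hf1 : MemLp f 1 volume := memLp_one_iff_integrable.2 hf
  let g : C(Plane, C(Plane, Plane)) :=
    (ContinuousMap.mk (fun q : Plane × Plane => q.2 + q.1) (by fun_prop)).curry
  have hg : ∀ v, MeasurePreserving (g v) volume volume := fun v =>
    measurePreserving_add_right volume v
  have hc := Filter.Tendsto.compMeasurePreservingLp (p := 1) (l := 𝓝 (0 : Plane))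
    (f := fun _ => hf1.toLp f) tendsto_const_nhds (g.continuous.tendsto 0) hg (hg 0)
    ENNReal.one_ne_top
  have h1 := EMetric.tendsto_nhds.1 hc ε (pos_iff_ne_zero.2 hε)
  obtain ⟨δ, hδ, h2⟩ := Metric.eventually_nhds_iff.1 h1
  refine ⟨δ, hδ, fun v hv => ?_⟩
  have h3 := h2 (y := v) (by simpa using hv)
  simp only [Lp.toLp_compMeasurePreserving] at h3
  rw [Lp.edist_toLp_toLp, eLpNorm_one_eq_lintegral_enorm] at h3
  refine le_trans (le_of_eq ?_) h3.le
  congr 1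
  ext z
  simp [g]

lemma prod_le_prod_add_sum_sub {ι : Type*} (S : Finset ι) {a b : ι → ℝ≥0∞} (ha : ∀ i, a i ≤ 1)
    (hb : ∀ i, b i ≤ 1) : ∏ i ∈ S, a i ≤ ∏ i ∈ S, b i + ∑ i ∈ S, (a i - b i) := by
  classical
  induction S using Finset.induction_on with
  | empty => simp
  | insert j S hj ih =>
    rw [Finset.prod_insert hj, Finset.prod_insert hj, Finset.sum_insert hj]
    calc a j * ∏ i ∈ S, a i ≤ (b j + (a j - b j)) * ∏ i ∈ S, a i := by
          gcongr
          exact le_add_tsub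
      _ = b j * ∏ i ∈ S, a i + (a j - b j) * ∏ i ∈ S, a i := add_mul _ _ _
      _ ≤ b j * (∏ i ∈ S, b i + ∑ i ∈ S, (a i - b i)) + (a j - b j) * 1 := by
          gcongr
          exact Finset.prod_le_one' fun i _ => ha i
      _ ≤ b j * ∏ i ∈ S, b i + 1 * ∑ i ∈ S, (a i - b i) + (a j - b j) := by
          rw [mul_add, mul_one]
          gcongr
          exact hb j
      _ = _ := by ring

/-- The functional `exp (-∑ a)` is Lipschitz in the factors `exp (-a i)`. -/
lemma negExp_tsum_le {a b c : ℕ → ℝ≥0∞} (h : ∀ m, negExp (a m) - negExp (b m) ≤ c m) :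
    negExp (∑' m, a m) ≤ negExp (∑' m, b m) + ∑' m, c m := by
  have ht : Tendsto (fun N => negExp (∑ m ∈ Finset.range N, b m) + ∑' m, c m) atTop
      (𝓝 (negExp (∑' m, b m) + ∑' m, c m)) :=
    ((continuous_negExp.tendsto _).comp (ENNReal.tendsto_nat_tsum b)).add_const _
  refine ge_of_tendsto' ht fun N => ?_
  calc negExp (∑' m, a m) ≤ negExp (∑ m ∈ Finset.range N, a m) :=
        negExp_antitone (ENNReal.sum_le_tsum _)
    _ ≤ negExp (∑ m ∈ Finset.range N, b m) +
        ∑ m ∈ Finset.range N, (negExp (a m) - negExp (b m)) := by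
        rw [negExp_sum, negExp_sum]
        exact prod_le_prod_add_sum_sub _ (fun _ => negExp_le_one _) fun _ => negExp_le_one _
    _ ≤ _ := by
        gcongr
        exact (Finset.sum_le_sum fun m _ => h m).trans (ENNReal.sum_le_tsum _)

lemma negExp_sub_negExp_le (x y : ℝ≥0) :
    negExp x - negExp y ≤ ‖(1 - Real.exp (-x)) - (1 - Real.exp (-y))‖ₑ := by
  rw [← ENNReal.ofReal_coe_nnreal (p := x), ← ENNReal.ofReal_coe_nnreal (p := y),
    negExp_ofReal x.coe_nonneg, negExp_ofReal y.coe_nonneg,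
    ← ENNReal.ofReal_sub _ (Real.exp_pos _).le, Real.enorm_eq_ofReal_abs]
  apply ENNReal.ofReal_le_ofReal
  rw [sub_sub_sub_cancel_left, abs_sub_comm]
  exact le_abs_self _

lemma one_sub_negExp_coe (x : ℝ≥0) :
    1 - negExp x = ENNReal.ofReal (1 - Real.exp (-x)) := by
  rw [← ENNReal.ofReal_coe_nnreal (p := x), negExp_ofReal x.coe_nonneg,
    ENNReal.ofReal_sub _ (Real.exp_pos _).le, ENNReal.ofReal_one]

section

variable {Ω : Type*} [MeasurableSpace Ω] {P : Measure Ω} {d : ℝ} {Y : ℕ → Ω → Plane}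

/-- Decomposition of a sum over the points in `W` along a countable partition of `W`. -/
lemma lintegral_tsum_partition {W : Set Plane} {A : ℕ → Set Plane}
    (hA : ∀ i, MeasurableSet (A i)) (hdisj : Pairwise (Function.onFun Disjoint A))
    (hU : ⋃ i, A i = W) (hY : ∀ n, Measurable (Y n)) {S : ℕ → Ω → ℝ≥0∞}
    (hS : ∀ n, Measurable (S n)) :
    ∫⁻ ω, ∑' n, W.indicator 1 (Y n ω) * S n ω ∂P =
      ∑' i, ∫⁻ ω, ∑' n, (A i).indicator 1 (Y n ω) * S n ω ∂P := by
  have hAm : ∀ i n, Measurable fun ω => (A i).indicator (1 : Plane → ℝ≥0∞) (Y n ω) := fun i n =>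
    (measurable_one.indicator (hA i)).comp (hY n)
  rw [← lintegral_tsum fun i => (Measurable.tsum fun n => by fun_prop).aemeasurable]
  congr 1
  ext ω
  rw [ENNReal.tsum_comm]
  congr 1
  ext n
  rw [ENNReal.tsum_mul_right, ← hU]
  congr 1
  by_cases hy : Y n ω ∈ ⋃ i, A i
  · obtain ⟨i, hi⟩ := Set.mem_iUnion.1 hy
    rw [tsum_eq_single i fun j hj => Set.indicator_of_notMem
      (fun hj' => Set.disjoint_left.1 (hdisj hj) hj' hi) _, Set.indicator_of_mem hi,
      Set.indicator_of_mem hy]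
  · rw [Set.indicator_of_notMem hy, ENNReal.tsum_eq_zero.2 fun i =>
      Set.indicator_of_notMem (fun hi => hy (Set.mem_iUnion.2 ⟨i, hi⟩)) _]

/-- **Slivnyak–Mecke formula** for the functional `exp (-∑ k (y - z))`, the sum being over the
points `z` other than the point `y`. -/
theorem IsHomogeneousPPP.mecke_translate [IsProbabilityMeasure P]
    (h : IsHomogeneousPPP P d Y) (hd : 0 ≤ d) {k : Plane → ℝ≥0} (hk : Measurable k)
    (hk' : ∫⁻ z, (1 - negExp (k z)) ≠ ∞) {W : Set Plane} (hW : MeasurableSet W)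
    (hW' : volume W ≠ ∞) :
    ∫⁻ ω, ∑' n, W.indicator 1 (Y n ω) * negExp (restSum Y (fun z => k (Y n ω - z)) n ω) ∂P =
      ENNReal.ofReal d * volume W * negExp (ENNReal.ofReal d * ∫⁻ z, (1 - negExp (k z))) := by
  have hYm := h.measurable
  set Φ := negExp (ENNReal.ofReal d * ∫⁻ z, (1 - negExp (k z)))
  set C := ENNReal.ofReal d * ENNReal.ofReal d * volume W
  have hC : C ≠ ∞ := ENNReal.mul_ne_top
    (ENNReal.mul_ne_top ENNReal.ofReal_ne_top ENNReal.ofReal_ne_top) hW'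
  -- The function whose translates are compared in `L¹`.
  set f : Plane → ℝ := fun z => 1 - Real.exp (-(k z))
  have hfm : Measurable f := by fun_prop
  have hf0 : ∀ z, 0 ≤ f z := fun z => by simp [f]
  have hf : Integrable f := by
    refine ⟨hfm.aestronglyMeasurable, ?_⟩
    rw [hasFiniteIntegral_iff_ofReal (ae_of_all _ hf0)]
    simp_rw [one_sub_negExp_coe] at hk'
    exact hk'.lt_top
  set E := ∫⁻ ω, ∑' n, W.indicator 1 (Y n ω) *
    negExp (restSum Y (fun z => k (Y n ω - z)) n ω) ∂P
  have key : ∀ ε : ℝ≥0∞, ε ≠ 0 → E ≤ ENNReal.ofReal d * volume W * Φ + C * ε ∧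
      ENNReal.ofReal d * volume W * Φ ≤ E + C * ε := by
    intro ε hε
    obtain ⟨δ, hδ, hδf⟩ := exists_lintegral_translate_le hf hε
    -- A countable partition of `W` into cells `A i`, each within `δ` of a point `p i`.
    set p : ℕ → Plane := TopologicalSpace.denseSeq Plane
    set A : ℕ → Set Plane := fun i => disjointed (fun j => Metric.ball (p j) δ) i ∩ W
    have hA : ∀ i, MeasurableSet (A i) := fun i =>
      (MeasurableSet.disjointed (fun j => Metric.isOpen_ball.measurableSet) i).inter hW
    have hAp : ∀ i, ∀ y ∈ A i, ‖y - p i‖ < δ := fun i y hy => by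
      simpa [dist_eq_norm] using disjointed_subset _ i hy.1
    have hdisj : Pairwise (Function.onFun Disjoint A) := fun i j hij =>
      (disjoint_disjointed _ hij).mono Set.inter_subset_left Set.inter_subset_left
    have hU : ⋃ i, A i = W := by
      rw [← Set.iUnion_inter, iUnion_disjointed, Set.inter_eq_right]
      intro y _
      obtain ⟨i, hi⟩ := (TopologicalSpace.denseRange_denseSeq Plane).exists_dist_lt y hδ
      exact Set.mem_iUnion.2 ⟨i, hi⟩
    have hvol : ∑' i, volume (A i) = volume W := by
      rw [← hU, measure_iUnion hdisj hA]
    have hvolA : ∀ i, volume (A i) ≠ ∞ := fun i =>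
      ne_top_of_le_ne_top hW' (measure_mono Set.inter_subset_right)
    have hAY : ∀ i n, Measurable fun ω => (A i).indicator (1 : Plane → ℝ≥0∞) (Y n ω) := fun i n =>
      (measurable_one.indicator (hA i)).comp (hYm n)
    set S : ℕ → Ω → ℝ≥0∞ := fun n ω => negExp (restSum Y (fun z => k (Y n ω - z)) n ω)
    set T : ℕ → ℕ → Ω → ℝ≥0∞ := fun i n ω => negExp (restSum Y (fun z => k (p i - z)) n ω)
    set D : ℕ → ℕ → Ω → ℝ≥0∞ := fun i n ω =>
      restSum Y (fun z => ‖f (Y n ω - z) - f (p i - z)‖ₑ) n ω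
    have hSm : ∀ n, Measurable (S n) := fun n => by
      refine measurable_negExp.comp (Measurable.tsum fun m => ?_)
      split_ifs <;> fun_prop
    have hTm : ∀ i n, Measurable (T i n) := fun i n => by
      refine measurable_negExp.comp (Measurable.tsum fun m => ?_)
      split_ifs <;> fun_prop
    have hDm : ∀ i n, Measurable (D i n) := fun i n => by
      refine Measurable.tsum fun m => ?_
      split_ifs <;> fun_prop
    have hST : ∀ i n ω, S n ω ≤ T i n ω + D i n ω := fun i n ω => by
      refine negExp_tsum_le fun m => ?_
      split_ifs
      · simp
      · exact negExp_sub_negExp_le _ _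
    have hTS : ∀ i n ω, T i n ω ≤ S n ω + D i n ω := fun i n ω => by
      refine negExp_tsum_le fun m => ?_
      split_ifs
      · simp
      · exact (negExp_sub_negExp_le _ _).trans_eq (enorm_sub_rev _ _)
    have hT : ∀ i, ∫⁻ ω, ∑' n, (A i).indicator 1 (Y n ω) * T i n ω ∂P =
        ENNReal.ofReal d * volume (A i) * Φ := fun i => by
      rw [h.palm_negExp hd (u := fun z => k (p i - z)) (by fun_prop)
        (measurable_one.indicator (hA i)), lintegral_indicator_one (hA i),
        lintegral_sub_left_eq_self (fun z => 1 - negExp (k z)) (p i)]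
    have hD : ∀ i, ∫⁻ ω, ∑' n, (A i).indicator 1 (Y n ω) * D i n ω ∂P ≤
        ENNReal.ofReal d * ENNReal.ofReal d * (volume (A i) * ε) := fun i => by
      rw [h.lintegral_pairs hd (hA i) (hvolA i)
        (F := fun y z => ‖f (y - z) - f (p i - z)‖ₑ) (by fun_prop)]
      gcongr
      rw [mul_comm, ← setLIntegral_const]
      refine setLIntegral_mono' (hA i) fun y hy => ?_
      have h1 := hδf (y - p i) (hAp i y hy)
      rw [← lintegral_sub_left_eq_self _ (p i)] at h1
      refine le_trans (le_of_eq ?_) h1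
      congr 1
      ext z
      congr 3
      abel
    have hDsum : ∑' i, ∫⁻ ω, ∑' n, (A i).indicator 1 (Y n ω) * D i n ω ∂P ≤ C * ε := by
      refine (ENNReal.tsum_le_tsum hD).trans (le_of_eq ?_)
      rw [ENNReal.tsum_mul_left, ENNReal.tsum_mul_right, hvol, ← mul_assoc]
    have hTsum : ∑' i, ∫⁻ ω, ∑' n, (A i).indicator 1 (Y n ω) * T i n ω ∂P =
        ENNReal.ofReal d * volume W * Φ := by
      simp_rw [hT]
      rw [ENNReal.tsum_mul_right, ENNReal.tsum_mul_left, hvol]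
    have hE : E = ∑' i, ∫⁻ ω, ∑' n, (A i).indicator 1 (Y n ω) * S n ω ∂P :=
      lintegral_tsum_partition hA hdisj hU hYm hSm
    have hcomp : ∀ i (U V : ℕ → Ω → ℝ≥0∞), (∀ n, Measurable (V n)) →
        (∀ n ω, U n ω ≤ V n ω + D i n ω) →
        ∫⁻ ω, ∑' n, (A i).indicator 1 (Y n ω) * U n ω ∂P ≤
          ∫⁻ ω, ∑' n, (A i).indicator 1 (Y n ω) * V n ω ∂P +
          ∫⁻ ω, ∑' n, (A i).indicator 1 (Y n ω) * D i n ω ∂P := by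
      intro i U V hV hUV
      rw [← lintegral_add_left (Measurable.tsum fun n => by fun_prop)]
      refine lintegral_mono fun ω => ?_
      rw [← ENNReal.tsum_add]
      refine ENNReal.tsum_le_tsum fun n => ?_
      rw [← mul_add]
      exact mul_le_mul_right (hUV n ω) _
    constructor
    · rw [hE, ← hTsum]
      refine (ENNReal.tsum_le_tsum fun i => hcomp i S (T i) (hTm i) (hST i)).trans ?_
      rw [ENNReal.tsum_add]
      gcongr
    · rw [hE, ← hTsum]
      refine (ENNReal.tsum_le_tsum fun i => hcomp i (T i) S hSm (hTS i)).trans ?_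
      rw [ENNReal.tsum_add]
      gcongr
  have hlim : ∀ x : ℝ≥0∞, Tendsto (fun n : ℕ => x + C * (n : ℝ≥0∞)⁻¹) atTop (𝓝 x) := fun x => by
    have := (ENNReal.Tendsto.const_mul ENNReal.tendsto_inv_nat_nhds_zero (Or.inr hC)).const_add x
    simpa using this
  have hne : ∀ n : ℕ, (n : ℝ≥0∞)⁻¹ ≠ 0 := fun n => by simp
  exact le_antisymm (ge_of_tendsto' (hlim _) fun n => (key _ (hne n)).1)
    (ge_of_tendsto' (hlim _) fun n => (key _ (hne n)).2)

end

/-! ### The antenna gain -/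

/-- The Fejér kernel is the square of a normalized Chebyshev polynomial of the second kind in
`cos (π g)`; the value `1` at the integers is `U_{M-1} (± 1) = ± M`. -/
lemma fejer_eq_chebyshev {M : ℕ} (hM : 1 ≤ M) (g : ℝ) :
    fejer M g =
      (((Polynomial.Chebyshev.U ℝ (M - 1 : ℤ)).eval (Real.cos (Real.pi * g))) / M) ^ 2 := by
  have hM0 : (M : ℝ) ≠ 0 := by positivity
  unfold fejer
  split_ifs with h
  · rcases Real.sin_eq_zero_iff_cos_eq.1 h with h1 | h1
    · rw [h1, Polynomial.Chebyshev.U_eval_one]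
      push_cast
      field_simp
      ring
    · rw [h1, Polynomial.Chebyshev.U_eval_neg_one]
      push_cast
      rcases Int.even_or_odd (M - 1 : ℤ) with h2 | h2
      · rw [Int.negOnePow_even _ h2]
        field_simp
        push_cast
        ring
      · rw [Int.negOnePow_odd _ h2]
        field_simp
        push_cast
        ring
  · have h1 := Polynomial.Chebyshev.U_real_cos (Real.pi * g) (M - 1 : ℤ)
    push_cast at h1
    rw [sub_add_cancel, show (M : ℝ) * (Real.pi * g) = Real.pi * M * g by ring] at h1
    rw [← h1]
    field_simp

lemma continuous_fejer {M : ℕ} (hM : 1 ≤ M) : Continuous (fejer M) := by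
  rw [show fejer M = _ from funext (fejer_eq_chebyshev hM)]
  fun_prop

lemma fejer_nonneg (M : ℕ) (g : ℝ) : 0 ≤ fejer M g := by
  unfold fejer
  split_ifs <;> positivity

lemma abs_sin_nat_mul_le (n : ℕ) (x : ℝ) : |Real.sin (n * x)| ≤ n * |Real.sin x| := by
  induction n with
  | zero => simp
  | succ n ih =>
    have h : Real.sin ((n + 1 : ℕ) * x) =
        Real.sin (n * x) * Real.cos x + Real.cos (n * x) * Real.sin x := by
      rw [← Real.sin_add]
      push_cast
      ring_nf
    rw [h]
    calc _ ≤ |Real.sin (n * x)| * |Real.cos x| + |Real.cos (n * x)| * |Real.sin x| := by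
          rw [← abs_mul, ← abs_mul]
          exact abs_add_le _ _
      _ ≤ n * |Real.sin x| * 1 + 1 * |Real.sin x| := by
          gcongr
          · exact Real.abs_cos_le_one x
          · exact Real.abs_cos_le_one _
      _ = _ := by
          push_cast
          ring

lemma fejer_le_one (M : ℕ) (g : ℝ) : fejer M g ≤ 1 := by
  unfold fejer
  split_ifs with h
  · exact le_rfl
  · refine div_le_one_of_le₀ ?_ (by positivity)
    have h1 := abs_sin_nat_mul_le M (Real.pi * g)
    rw [← sq_abs, ← sq_abs (Real.sin (Real.pi * g)), ← mul_pow,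
      show Real.pi * M * g = M * (Real.pi * g) by ring]
    gcongr

/-! ### Averaging over fading, beam angles and user positions -/

lemma measurable_pathLoss (p : Params) : Measurable (pathLoss p) := by
  unfold pathLoss
  exact Measurable.ite measurableSet_Iic (by fun_prop) (by fun_prop)

/-- The power received over a link of length `r` with LOS fading amplitude `l.1`, NLOS fading
amplitude `l.2.1` and angle `l.2.2`. -/
def linkPower (p : Params) (l : ℝ × ℝ × ℝ) (r : ℝ) : ℝ :=
  p.M * (if r ≤ p.RL then l.1 else l.2.1) ^ 2 * fejer p.M l.2.2 * pathLoss p r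

/-- The law of the variables of a link. -/
def linkLaw (p : Params) : Measure (ℝ × ℝ × ℝ) :=
  (nakagami p.NL).prod ((nakagami p.NN).prod (angleLaw p))

/-- The Laplace transform at `s` of the power received over a link of length `r`. -/
def linkLaplace (p : Params) (s r : ℝ) : ℝ≥0∞ :=
  ∫⁻ l, negExp (ENNReal.ofReal s * ENNReal.ofReal (linkPower p l r)) ∂linkLaw p

lemma measurable_linkPower {p : Params} (hM : 1 ≤ p.M) :
    Measurable fun q : (ℝ × ℝ × ℝ) × ℝ => linkPower p q.1 q.2 := by
  unfold linkPower
  have h1 : Measurable fun q : (ℝ × ℝ × ℝ) × ℝ => if q.2 ≤ p.RL then q.1.1 else q.1.2.1 :=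
    Measurable.ite (measurableSet_le measurable_snd measurable_const) (by fun_prop) (by fun_prop)
  have h2 := (continuous_fejer hM).measurable
  have h3 := measurable_pathLoss p
  fun_prop

/-- Two independent random elements can be integrated separately. -/
lemma lintegral_indepFun {Ω α β : Type*} [MeasurableSpace Ω] [MeasurableSpace α]
    [MeasurableSpace β] {P : Measure Ω} [IsProbabilityMeasure P] {f : Ω → α} {g : Ω → β}
    (hf : Measurable f) (hg : Measurable g) (h : IndepFun f g P) {F : α → β → ℝ≥0∞}
    (hF : Measurable fun q : α × β => F q.1 q.2) :
    ∫⁻ ω, F (f ω) (g ω) ∂P = ∫⁻ ω, ∫⁻ ω', F (f ω) (g ω') ∂P ∂P := by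
  have h1 := (indepFun_iff_map_prod_eq_prod_map_map hf.aemeasurable hg.aemeasurable).1 h
  calc ∫⁻ ω, F (f ω) (g ω) ∂P = ∫⁻ q, F q.1 q.2 ∂(P.map fun ω => (f ω, g ω)) :=
        (lintegral_map hF (hf.prodMk hg)).symm
    _ = ∫⁻ x, ∫⁻ y, F x y ∂(P.map g) ∂(P.map f) := by
        rw [h1, lintegral_prod _ hF.aemeasurable]
    _ = ∫⁻ ω, ∫⁻ y, F (f ω) y ∂(P.map g) ∂P :=
        lintegral_map hF.lintegral_prod_right' hf
    _ = _ := by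
        congr 1
        ext ω
        exact lintegral_map (hF.comp measurable_prodMk_left) hg

section

variable {Ω : Type*} [MeasurableSpace Ω] {P : Measure Ω} {p : Params}
  {ν : Measure Plane} {Y X : ℕ → Ω → Plane} {gL gN θ : ℕ → ℕ → Ω → ℝ}

lemma IsNetwork.measurable_link (h : IsNetwork p P ν Y X gL gN θ) (n m : ℕ) :
    Measurable fun ω => (gL n m ω, gN n m ω, θ n m ω) :=
  (h.measurable_gL n m).prodMk ((h.measurable_gN n m).prodMk (h.measurable_θ n m))

variable [IsProbabilityMeasure P]

lemma IsNetwork.isProbabilityMeasure_user (h : IsNetwork p P ν Y X gL gN θ) :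
    IsProbabilityMeasure ν := by
  rw [← h.law_user 0]
  exact Measure.isProbabilityMeasure_map (h.measurable_user 0).aemeasurable

lemma IsNetwork.isProbabilityMeasure_link (h : IsNetwork p P ν Y X gL gN θ) :
    IsProbabilityMeasure (linkLaw p) := by
  unfold linkLaw
  rw [← h.law_link 0 0]
  exact Measure.isProbabilityMeasure_map (h.measurable_link 0 0).aemeasurable

lemma measurable_linkLaplace [IsProbabilityMeasure (linkLaw p)] (hM : 1 ≤ p.M) (s : ℝ) :
    Measurable (linkLaplace p s) := by
  have h1 := measurable_linkPower hM
  have h2 : Measurable fun q : ℝ × (ℝ × ℝ × ℝ) =>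
      negExp (ENNReal.ofReal s * ENNReal.ofReal (linkPower p q.2 q.1)) := by
    have := h1.comp measurable_swap
    simp only [Function.comp_def, Prod.fst_swap, Prod.snd_swap] at this
    fun_prop
  exact h2.lintegral_prod_right'

lemma linkLaplace_le_one [IsProbabilityMeasure (linkLaw p)] (s r : ℝ) :
    linkLaplace p s r ≤ 1 := by
  calc linkLaplace p s r ≤ ∫⁻ _, 1 ∂linkLaw p := lintegral_mono fun _ => negExp_le_one _
    _ = 1 := by simp

lemma linkLaplace_ne_zero [IsProbabilityMeasure (linkLaw p)] (hM : 1 ≤ p.M) (s r : ℝ) :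
    linkLaplace p s r ≠ 0 := by
  have h1 := measurable_linkPower hM
  have h2 : Measurable fun l => linkPower p l r := h1.comp measurable_prodMk_right
  unfold linkLaplace
  intro h0
  rw [lintegral_eq_zero_iff (by fun_prop)] at h0
  have h3 : ∀ᵐ _ ∂linkLaw p, False := h0.mono fun l hl =>
    negExp_ne_zero (ENNReal.mul_ne_top ENNReal.ofReal_ne_top ENNReal.ofReal_ne_top) hl
  simp [IsProbabilityMeasure.ne_zero] at h3

/-- The function `κ` with `exp (-κ r) = E exp (-s c)` for the power `c` received over a link of
length `r`. -/
def linkCost (p : Params) (s r : ℝ) : ℝ≥0 := (-Real.log (linkLaplace p s r).toReal).toNNReal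

lemma negExp_linkCost [IsProbabilityMeasure (linkLaw p)] (hM : 1 ≤ p.M) (s r : ℝ) :
    negExp (linkCost p s r) = linkLaplace p s r := by
  have h1 := linkLaplace_ne_zero hM s r
  have h2 := linkLaplace_le_one (p := p) s r
  have h3 : linkLaplace p s r ≠ ∞ := ne_top_of_le_ne_top ENNReal.one_ne_top h2
  have h4 : 0 < (linkLaplace p s r).toReal := ENNReal.toReal_pos h1 h3
  have h5 : (linkLaplace p s r).toReal ≤ 1 := by
    simpa using ENNReal.toReal_mono ENNReal.one_ne_top h2
  change negExp (ENNReal.ofReal _) = _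
  rw [negExp_ofReal (by simpa using Real.log_nonpos h4.le h5), neg_neg, Real.exp_log h4,
    ENNReal.ofReal_toReal h3]

/-- The average of a product over finitely many links to one user. -/
lemma IsNetwork.lintegral_prod_link (h : IsNetwork p P ν Y X gL gN θ)
    {ψ : (ℝ × ℝ × ℝ) → ℝ → ℝ≥0∞} (hψ : Measurable fun q : (ℝ × ℝ × ℝ) × ℝ => ψ q.1 q.2)
    {φ : ℝ → ℝ≥0∞} (hφ : Measurable φ) (hψφ : ∀ r, ∫⁻ l, ψ l r ∂linkLaw p = φ r)
    {w : Plane → ℝ≥0∞} (hw : Measurable w) (n : ℕ) (S : Finset ℕ) :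
    ∫⁻ ω, w (Y n ω) * ∏ m ∈ S, ψ (gL n m ω, gN n m ω, θ n m ω) ‖X n ω + (Y n ω - Y m ω)‖ ∂P =
      ∫⁻ x, ∫⁻ ω, w (Y n ω) * ∏ m ∈ S, φ ‖x + (Y n ω - Y m ω)‖ ∂P ∂ν := by
  have hY := h.ppp.measurable
  have hX := h.measurable_user
  set L : ℕ → Ω → ℝ × ℝ × ℝ := fun m ω => (gL n m ω, gN n m ω, θ n m ω)
  have hL : ∀ m, Measurable (L m) := h.measurable_link n
  have hlink : ∀ r : ℕ → ℝ, ∫⁻ ω, ∏ m ∈ S, ψ (L m ω) (r m) ∂P = ∏ m ∈ S, φ (r m) := by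
    intro r
    have hψr : ∀ m, Measurable fun l => ψ l (r m) := fun m => hψ.comp measurable_prodMk_right
    rw [lintegral_prod_eq_prod_lintegral_of_indepFun S (fun m ω => ψ (L m ω) (r m))]
    · refine Finset.prod_congr rfl fun m _ => ?_
      rw [← hψφ, linkLaw, ← h.law_link n m, lintegral_map (hψr m) (hL m)]
    · exact (h.indep_link.precomp (Prod.mk_right_injective n)).comp (fun m l => ψ l (r m)) hψr
    · exact fun m => (hψr m).comp (hL m)
  have hΛ : Measurable fun ω (l : ℕ × ℕ) => (gL l.1 l.2 ω, gN l.1 l.2 ω, θ l.1 l.2 ω) :=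
    measurable_pi_lambda _ fun l => h.measurable_link l.1 l.2
  have hZ : Measurable fun ω n => (Y n ω, X n ω) :=
    measurable_pi_lambda _ fun n => (hY n).prodMk (hX n)
  have hF : Measurable fun q : (ℕ → Plane × Plane) × (ℕ × ℕ → ℝ × ℝ × ℝ) =>
      w (q.1 n).1 * ∏ m ∈ S, ψ (q.2 (n, m)) ‖(q.1 n).2 + ((q.1 n).1 - (q.1 m).1)‖ := by
    have hq : ∀ m, Measurable fun q : (ℕ → Plane × Plane) × (ℕ × ℕ → ℝ × ℝ × ℝ) => q.1 m :=
      fun m => (measurable_pi_apply m).comp measurable_fst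
    have hq' : ∀ m, Measurable fun q : (ℕ → Plane × Plane) × (ℕ × ℕ → ℝ × ℝ × ℝ) => q.2 m :=
      fun m => (measurable_pi_apply m).comp measurable_snd
    refine (hw.comp (hq n).fst).mul (Finset.measurable_fun_prod _ fun m _ => ?_)
    exact hψ.comp ((hq' (n, m)).prodMk
      ((hq n).snd.add ((hq n).fst.sub (hq m).fst)).norm)
  have hG : Measurable fun q : (ℕ → Plane) × (ℕ → Plane) =>
      w (q.2 n) * ∏ m ∈ S, φ ‖q.1 n + (q.2 n - q.2 m)‖ := by
    have hq : ∀ m, Measurable fun q : (ℕ → Plane) × (ℕ → Plane) => q.1 m :=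
      fun m => (measurable_pi_apply m).comp measurable_fst
    have hq' : ∀ m, Measurable fun q : (ℕ → Plane) × (ℕ → Plane) => q.2 m :=
      fun m => (measurable_pi_apply m).comp measurable_snd
    refine (hw.comp (hq' n)).mul (Finset.measurable_fun_prod _ fun m _ => ?_)
    exact hφ.comp ((hq n).add ((hq' n).sub (hq' m))).norm
  have hH : Measurable fun q : Plane × Ω =>
      w (Y n q.2) * ∏ m ∈ S, φ ‖q.1 + (Y n q.2 - Y m q.2)‖ := by fun_prop
  calc ∫⁻ ω, w (Y n ω) * ∏ m ∈ S, ψ (L m ω) ‖X n ω + (Y n ω - Y m ω)‖ ∂P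
      = ∫⁻ ω, ∫⁻ ω', w (Y n ω) * ∏ m ∈ S, ψ (L m ω') ‖X n ω + (Y n ω - Y m ω)‖ ∂P ∂P :=
        lintegral_indepFun (F := fun (z : ℕ → Plane × Plane) (l : ℕ × ℕ → ℝ × ℝ × ℝ) =>
          w (z n).1 * ∏ m ∈ S, ψ (l (n, m)) ‖(z n).2 + ((z n).1 - (z m).1)‖)
          hZ hΛ h.indep_position_link hF
    _ = ∫⁻ ω, w (Y n ω) * ∏ m ∈ S, φ ‖X n ω + (Y n ω - Y m ω)‖ ∂P := by
        congr 1
        ext ω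
        rw [lintegral_const_mul, hlink]
        exact Finset.measurable_fun_prod _ fun m _ => hψ.comp ((hL m).prodMk measurable_const)
    _ = ∫⁻ ω', ∫⁻ ω, w (Y n ω) * ∏ m ∈ S, φ ‖X n ω' + (Y n ω - Y m ω)‖ ∂P ∂P :=
        lintegral_indepFun (F := fun (x y : ℕ → Plane) =>
          w (y n) * ∏ m ∈ S, φ ‖x n + (y n - y m)‖)
          (measurable_pi_lambda _ hX) (measurable_pi_lambda _ hY) h.indep_user.symm hG
    _ = ∫⁻ x, ∫⁻ ω, w (Y n ω) * ∏ m ∈ S, φ ‖x + (Y n ω - Y m ω)‖ ∂P ∂ν := by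
        rw [← h.law_user n, lintegral_map hH.lintegral_prod_right' (hX n)]

/-- The average of `exp (-s I)` over the fading, the angles and the position of the user. -/
lemma IsNetwork.lintegral_expNeg_interference (h : IsNetwork p P ν Y X gL gN θ) (hM : 1 ≤ p.M)
    {W : Set Plane} (hW : MeasurableSet W) {s : ℝ} (hs : 0 < s) (n : ℕ) :
    ∫⁻ ω, W.indicator 1 (Y n ω) * expNeg s (interference p Y X gL gN θ n ω) ∂P =
      ∫⁻ x, ∫⁻ ω, W.indicator 1 (Y n ω) *
        negExp (restSum Y (fun z => linkCost p s ‖x + (Y n ω - z)‖) n ω) ∂P ∂ν := by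
  have hprob := h.isProbabilityMeasure_link
  have hprobν := h.isProbabilityMeasure_user
  have hY := h.ppp.measurable
  have hX := h.measurable_user
  have hlap := measurable_linkLaplace (p := p) hM s
  have hWm : Measurable (W.indicator (1 : Plane → ℝ≥0∞)) := measurable_one.indicator hW
  have hW1 : ∀ y, W.indicator (1 : Plane → ℝ≥0∞) y ≤ 1 := fun y =>
    Set.indicator_le_self' (by simp) y
  have hWt : ∀ y, W.indicator (1 : Plane → ℝ≥0∞) y ≠ ∞ := fun y =>
    ne_top_of_le_ne_top ENNReal.one_ne_top (hW1 y)
  -- The factor of one link.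
  obtain ⟨ψ, hψ_eq⟩ : ∃ ψ : (ℝ × ℝ × ℝ) → ℝ → ℝ≥0∞, ∀ l r, ψ l r =
      negExp (ENNReal.ofReal s * ENNReal.ofReal (linkPower p l r)) := ⟨_, fun _ _ => rfl⟩
  have hψ : Measurable fun q : (ℝ × ℝ × ℝ) × ℝ => ψ q.1 q.2 := by
    simp_rw [hψ_eq]
    exact measurable_negExp.comp (measurable_const.mul (measurable_linkPower hM).ennreal_ofReal)
  have hψ1 : ∀ l r, ψ l r ≤ 1 := fun l r => by
    rw [hψ_eq]
    exact negExp_le_one _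
  have hfinite := h.lintegral_prod_link hψ hlap
    (fun r => by simp_rw [hψ_eq, linkLaplace]) hWm n
  have hlim : ∀ (a : ℕ → ℝ≥0∞), Tendsto (fun N => ∏ m ∈ (Finset.range N).erase n, negExp (a m))
      atTop (𝓝 (negExp (∑' m, if m = n then 0 else a m))) := by
    intro a
    have : ∀ N, ∏ m ∈ (Finset.range N).erase n, negExp (a m) =
        negExp (∑ m ∈ Finset.range N, if m = n then 0 else a m) := by
      intro N
      rw [← negExp_sum, Finset.sum_ite, Finset.sum_const_zero, zero_add, Finset.filter_ne']
    simp_rw [this]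
    exact (continuous_negExp.tendsto _).comp (ENNReal.tendsto_nat_tsum _)
  have hprod1 : ∀ (S : Finset ℕ) (b : ℕ → ℝ≥0∞), (∀ m, b m ≤ 1) → ∀ y,
      W.indicator (1 : Plane → ℝ≥0∞) y * ∏ m ∈ S, b m ≤ 1 := fun S b hb y =>
    mul_le_one' (hW1 y) (Finset.prod_le_one' fun m _ => hb m)
  have hLHS : Tendsto (fun N => ∫⁻ ω, W.indicator 1 (Y n ω) * ∏ m ∈ (Finset.range N).erase n,
        ψ (gL n m ω, gN n m ω, θ n m ω) ‖X n ω + (Y n ω - Y m ω)‖ ∂P) atTop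
      (𝓝 (∫⁻ ω, W.indicator 1 (Y n ω) * expNeg s (interference p Y X gL gN θ n ω) ∂P)) := by
    refine tendsto_lintegral_of_dominated_convergence (fun _ => 1) (fun N => ?_)
      (fun N => ae_of_all _ fun ω => hprod1 _ _ (fun m => hψ1 _ _) _) (by simp)
      (ae_of_all _ fun ω => ENNReal.Tendsto.const_mul ?_ (Or.inr (hWt _)))
    · refine (hWm.comp (hY n)).mul (Finset.measurable_fun_prod _ fun m _ => ?_)
      exact hψ.comp ((h.measurable_link n m).prodMk ((hX n).add ((hY n).sub (hY m))).norm)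
    · have h1 := hlim fun m => ENNReal.ofReal s * ENNReal.ofReal
        (linkPower p (gL n m ω, gN n m ω, θ n m ω) ‖X n ω + (Y n ω - Y m ω)‖)
      simp_rw [← hψ_eq] at h1
      rw [expNeg_eq_negExp hs, interference, ← ENNReal.tsum_mul_left]
      simp only [mul_ite, mul_zero]
      exact h1
  have hinner : ∀ x, Tendsto (fun N => ∫⁻ ω, W.indicator 1 (Y n ω) *
        ∏ m ∈ (Finset.range N).erase n, linkLaplace p s ‖x + (Y n ω - Y m ω)‖ ∂P) atTop
      (𝓝 (∫⁻ ω, W.indicator 1 (Y n ω) *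
        negExp (restSum Y (fun z => linkCost p s ‖x + (Y n ω - z)‖) n ω) ∂P)) := by
    intro x
    refine tendsto_lintegral_of_dominated_convergence (fun _ => 1) (fun N => ?_)
      (fun N => ae_of_all _ fun ω => hprod1 _ _ (fun m => linkLaplace_le_one _ _) _) (by simp)
      (ae_of_all _ fun ω => ENNReal.Tendsto.const_mul ?_ (Or.inr (hWt _)))
    · refine (hWm.comp (hY n)).mul (Finset.measurable_fun_prod _ fun m _ => ?_)
      exact hlap.comp (((hY n).sub (hY m)).const_add x).norm
    · have h1 := hlim fun m => linkCost p s ‖x + (Y n ω - Y m ω)‖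
      simp only [negExp_linkCost hM] at h1
      exact h1
  have hRHS : Tendsto (fun N => ∫⁻ x, ∫⁻ ω, W.indicator 1 (Y n ω) *
        ∏ m ∈ (Finset.range N).erase n, linkLaplace p s ‖x + (Y n ω - Y m ω)‖ ∂P ∂ν) atTop
      (𝓝 (∫⁻ x, ∫⁻ ω, W.indicator 1 (Y n ω) *
        negExp (restSum Y (fun z => linkCost p s ‖x + (Y n ω - z)‖) n ω) ∂P ∂ν)) := by
    refine tendsto_lintegral_of_dominated_convergence (fun _ => 1) (fun N => ?_)
      (fun N => ae_of_all _ fun x => ?_) (by simp) (ae_of_all _ hinner)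
    · have : Measurable fun q : Plane × Ω => W.indicator 1 (Y n q.2) *
          ∏ m ∈ (Finset.range N).erase n, linkLaplace p s ‖q.1 + (Y n q.2 - Y m q.2)‖ := by
        fun_prop
      exact this.lintegral_prod_right'
    · calc _ ≤ ∫⁻ _, 1 ∂P := lintegral_mono fun ω =>
            hprod1 _ _ (fun m => linkLaplace_le_one _ _) _
        _ = 1 := by simp
  exact tendsto_nhds_unique (hLHS.congr fun N => hfinite _) hRHS

/-- The Laplace transform of the interference, in terms of that of a single link. The position of
the user relative to its base station drops out, because the plane is translation invariant. -/
theorem IsNetwork.laplaceInterference_eq (h : IsNetwork p P ν Y X gL gN θ) (hM : 1 ≤ p.M)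
    (hd : 0 < p.dens) {W : Set Plane} (hW : MeasurableSet W) (hW0 : volume W ≠ 0)
    (hW' : volume W ≠ ∞) {s : ℝ} (hs : 0 < s)
    (hfin : ∫⁻ z : Plane, (1 - linkLaplace p s ‖z‖) ≠ ∞) :
    laplaceInterference p P Y X gL gN θ W s =
      Real.exp (-(p.dens * (∫⁻ z : Plane, (1 - linkLaplace p s ‖z‖)).toReal)) := by
  have hprob := h.isProbabilityMeasure_link
  have hprobν := h.isProbabilityMeasure_user
  have hY := h.ppp.measurable
  have hX := h.measurable_user
  have hcost : Measurable (linkCost p s) := by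
    have hlap := measurable_linkLaplace (p := p) hM s
    unfold linkCost
    fun_prop
  have hWm : Measurable (W.indicator (1 : Plane → ℝ≥0∞)) := measurable_one.indicator hW
  have hWY : ∀ n, Measurable fun ω => W.indicator (1 : Plane → ℝ≥0∞) (Y n ω) := fun n =>
    hWm.comp (hY n)
  have hden : ∫⁻ ω, count Y W ω ∂P = ENNReal.ofReal p.dens * volume W := by
    simpa [pointSum] using h.ppp.lintegral_count_mul_negExp hd.le (u := fun _ => 0)
      measurable_const hW
  have hshift : ∀ x : Plane, ∫⁻ v, (1 - negExp (linkCost p s ‖x + v‖)) =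
      ∫⁻ z : Plane, (1 - linkLaplace p s ‖z‖) := by
    intro x
    simp_rw [negExp_linkCost hM]
    exact lintegral_add_left_eq_self (fun v : Plane => 1 - linkLaplace p s ‖v‖) x
  have hmeas : ∀ n, Measurable fun q : Plane × Ω => W.indicator 1 (Y n q.2) *
      negExp (restSum Y (fun z => linkCost p s ‖q.1 + (Y n q.2 - z)‖) n q.2) := by
    intro n
    have : Measurable fun q : Plane × Ω =>
        restSum Y (fun z => linkCost p s ‖q.1 + (Y n q.2 - z)‖) n q.2 := by
      refine Measurable.tsum fun m => ?_
      split_ifs <;> fun_prop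
    fun_prop
  have hmeas' : ∀ x n, Measurable fun ω => W.indicator 1 (Y n ω) *
      negExp (restSum Y (fun z => linkCost p s ‖x + (Y n ω - z)‖) n ω) := fun x n =>
    (hmeas n).comp measurable_prodMk_left
  have hint : ∀ n, Measurable (interference p Y X gL gN θ n) := by
    intro n
    refine Measurable.tsum fun m => ?_
    split_ifs
    · exact measurable_const
    · exact ENNReal.measurable_ofReal.comp ((measurable_linkPower hM).comp
        (f := fun ω => ((gL n m ω, gN n m ω, θ n m ω), ‖X n ω + (Y n ω - Y m ω)‖))
        ((h.measurable_link n m).prodMk (by fun_prop)))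
  have hnum : ∫⁻ ω, ∑' n, W.indicator 1 (Y n ω) * expNeg s (interference p Y X gL gN θ n ω) ∂P =
      ENNReal.ofReal p.dens * volume W *
        negExp (ENNReal.ofReal p.dens * ∫⁻ z : Plane, (1 - linkLaplace p s ‖z‖)) := by
    rw [lintegral_tsum fun n => by simp_rw [expNeg_eq_negExp hs]; fun_prop]
    simp_rw [h.lintegral_expNeg_interference hM hW hs]
    rw [← lintegral_tsum fun n => (hmeas n).lintegral_prod_right'.aemeasurable]
    simp_rw [← lintegral_tsum fun n => (hmeas' _ n).aemeasurable]
    have : ∀ x : Plane, ∫⁻ ω, ∑' n, W.indicator 1 (Y n ω) *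
        negExp (restSum Y (fun z => linkCost p s ‖x + (Y n ω - z)‖) n ω) ∂P =
        ENNReal.ofReal p.dens * volume W *
          negExp (ENNReal.ofReal p.dens * ∫⁻ z : Plane, (1 - linkLaplace p s ‖z‖)) := by
      intro x
      rw [h.ppp.mecke_translate hd.le (k := fun v => linkCost p s ‖x + v‖) (by fun_prop)
        (by rwa [hshift]) hW hW', hshift]
    simp_rw [this]
    simp
  rw [laplaceInterference, hnum, hden, mul_comm, ENNReal.mul_div_cancel_right, ←
    ENNReal.ofReal_toReal hfin, ← ENNReal.ofReal_mul hd.le, negExp_ofReal (by positivity),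
    ENNReal.toReal_ofReal (Real.exp_pos _).le, ENNReal.toReal_ofReal ENNReal.toReal_nonneg]
  · exact mul_ne_zero (by simpa using hd) hW0
  · exact ENNReal.mul_ne_top ENNReal.ofReal_ne_top hW'

end

/-! ### Euler integrals for the hypergeometric functions -/

lemma ofReal_mul_mem_cutPlane {z : ℂ} (hz : z ∈ cutPlane) {x : ℝ} (hx : x ∈ Set.Icc (0 : ℝ) 1) :
    (x : ℂ) * z ∈ cutPlane := by
  have h := Complex.starConvex_one_slitPlane hz (sub_nonneg.2 hx.2) hx.1 (by ring)
  have : 1 - (x : ℂ) * z = (1 - x) • (1 : ℂ) + x • (1 - z) := by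
    simp only [Complex.real_smul]
    push_cast
    ring
  change 1 - (x : ℂ) * z ∈ Complex.slitPlane
  rwa [this]

lemma neg_ofReal_mem_cutPlane {v : ℝ} (hv : 0 ≤ v) : ((-v : ℝ) : ℂ) ∈ cutPlane := by
  refine Or.inl ?_
  simp
  linarith

lemma integrableOn_rpow_unit {β : ℝ} (hβ : -1 < β) :
    IntegrableOn (fun x : ℝ => x ^ β) (Set.Ioo 0 1) := by
  have := (intervalIntegral.intervalIntegrable_rpow' (a := 0) (b := 1) hβ)
  rw [intervalIntegrable_iff_integrableOn_Ioo_of_le zero_le_one] at this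
  exact this

lemma setIntegral_rpow_unit {β : ℝ} (hβ : -1 < β) :
    ∫ x in Set.Ioo (0 : ℝ) 1, x ^ β = 1 / (β + 1) := by
  rw [← integral_Ioc_eq_integral_Ioo, ← intervalIntegral.integral_of_le zero_le_one,
    integral_rpow (Or.inl hβ), Real.one_rpow, Real.zero_rpow (by linarith), sub_zero]

/-- A weighted average of a holomorphic function over the segments issuing from `0` is
holomorphic. -/
lemma differentiableOn_integral_rpow_mul {H : ℂ → ℂ} (hH : DifferentiableOn ℂ H cutPlane) {β : ℝ}
    (hβ : -1 < β) :
    DifferentiableOn ℂ (fun z => ∫ x in Set.Ioo (0 : ℝ) 1, ((x ^ β : ℝ) : ℂ) * H (x * z))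
      cutPlane := by
  intro z₀ hz₀
  obtain ⟨r, hr, hball⟩ := Metric.isOpen_iff.1 isOpen_cutPlane z₀ hz₀
  have hK : Metric.closedBall z₀ (r / 2) ⊆ cutPlane :=
    (Metric.closedBall_subset_ball (by linarith)).trans hball
  have hHc : ContinuousOn H cutPlane := hH.continuousOn
  have hdc : ContinuousOn (deriv H) cutPlane := (hH.deriv isOpen_cutPlane).continuousOn
  -- The derivative is bounded on the compact set swept by the segments.
  have hcomp : IsCompact (Set.Icc (0 : ℝ) 1 ×ˢ Metric.closedBall z₀ (r / 2)) :=
    isCompact_Icc.prod (isCompact_closedBall _ _)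
  have hcont : ContinuousOn (fun q : ℝ × ℂ => deriv H ((q.1 : ℂ) * q.2))
      (Set.Icc (0 : ℝ) 1 ×ˢ Metric.closedBall z₀ (r / 2)) :=
    hdc.comp (by fun_prop) fun q hq => ofReal_mul_mem_cutPlane (hK hq.2) hq.1
  obtain ⟨C, hC⟩ := hcomp.exists_bound_of_continuousOn hcont
  have hmeas : ∀ (G : ℂ → ℂ), ContinuousOn G cutPlane → ∀ z ∈ cutPlane,
      ContinuousOn (fun x : ℝ => G (x * z)) (Set.Ioo 0 1) := fun G hG z hz =>
    hG.comp (by fun_prop) fun x hx => ofReal_mul_mem_cutPlane hz (Set.Ioo_subset_Icc_self hx)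
  have hpow : ContinuousOn (fun x : ℝ => ((x ^ β : ℝ) : ℂ)) (Set.Ioo 0 1) := by
    refine Complex.continuous_ofReal.comp_continuousOn ?_
    exact fun x hx => (Real.continuousAt_rpow_const x β (Or.inl hx.1.ne')).continuousWithinAt
  have hmeas' : ∀ (G : ℂ → ℂ), ContinuousOn G cutPlane → ∀ z ∈ cutPlane,
      AEStronglyMeasurable (fun x : ℝ => ((x ^ β : ℝ) : ℂ) * G (x * z))
        (volume.restrict (Set.Ioo 0 1)) := fun G hG z hz =>
    (hpow.mul (hmeas G hG z hz)).aestronglyMeasurable measurableSet_Ioo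
  have hpint := integrableOn_rpow_unit hβ
  have hnorm : ∀ x ∈ Set.Ioo (0 : ℝ) 1, ‖((x ^ β : ℝ) : ℂ)‖ = x ^ β := fun x hx => by
    rw [Complex.norm_real, Real.norm_of_nonneg (Real.rpow_nonneg hx.1.le β)]
  refine (hasDerivAt_integral_of_dominated_loc_of_deriv_le (μ := volume.restrict (Set.Ioo 0 1))
    (s := Metric.closedBall z₀ (r / 2)) (Metric.closedBall_mem_nhds _ (by linarith))
    (F := fun z (x : ℝ) => ((x ^ β : ℝ) : ℂ) * H (x * z))
    (F' := fun z (x : ℝ) => ((x ^ β : ℝ) : ℂ) * (x * deriv H (x * z)))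
    (bound := fun x => x ^ β * C) ?_ ?_ ?_ ?_ ?_ ?_).2.differentiableAt.differentiableWithinAt
  · filter_upwards [isOpen_cutPlane.mem_nhds hz₀] with z hz using hmeas' H hHc z hz
  · have hc : ContinuousOn (fun x : ℝ => H (x * z₀)) (Set.Icc 0 1) :=
      hHc.comp (by fun_prop) fun x hx => ofReal_mul_mem_cutPlane hz₀ hx
    obtain ⟨B, hB⟩ := isCompact_Icc.exists_bound_of_continuousOn hc
    refine Integrable.mono' (hpint.mul_const B) (hmeas' H hHc z₀ hz₀) ?_
    filter_upwards [ae_restrict_mem measurableSet_Ioo] with x hx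
    rw [norm_mul, hnorm x hx]
    exact mul_le_mul_of_nonneg_left (hB x (Set.Ioo_subset_Icc_self hx)) (Real.rpow_nonneg hx.1.le β)
  · refine (hpow.mul ?_).aestronglyMeasurable measurableSet_Ioo
    exact Complex.continuous_ofReal.continuousOn.mul (hmeas _ hdc z₀ hz₀)
  · filter_upwards [ae_restrict_mem measurableSet_Ioo] with x hx z hz
    rw [norm_mul, hnorm x hx, norm_mul, Complex.norm_real, Real.norm_of_nonneg hx.1.le]
    refine mul_le_mul_of_nonneg_left ?_ (Real.rpow_nonneg hx.1.le β)
    calc x * ‖deriv H (x * z)‖ ≤ 1 * ‖deriv H (x * z)‖ := by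
          gcongr
          exact hx.2.le
      _ ≤ C := by
          rw [one_mul]
          exact hC (x, z) ⟨Set.Ioo_subset_Icc_self hx, hz⟩
  · exact hpint.mul_const C
  · filter_upwards [ae_restrict_mem measurableSet_Ioo] with x hx z hz
    have h1 : HasDerivAt H (deriv H (x * z)) (x * z) :=
      (hH.differentiableAt (isOpen_cutPlane.mem_nhds
        (ofReal_mul_mem_cutPlane (hK hz) (Set.Ioo_subset_Icc_self hx)))).hasDerivAt
    have h2 : HasDerivAt (fun z : ℂ => (x : ℂ) * z) x z := by
      simpa using (hasDerivAt_id z).const_mul (x : ℂ)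
    have h3 := (h1.comp z h2).const_mul ((x ^ β : ℝ) : ℂ)
    rwa [mul_comm (deriv H _)] at h3

/-- Termwise integration of a power series along a segment issuing from `0`. -/
lemma hasSum_integral_rpow_mul {H : ℂ → ℂ} {h : ℕ → ℂ} {z : ℂ} {β : ℝ} (hβ : -1 < β)
    (hs : ∀ x ∈ Set.Ioo (0 : ℝ) 1, HasSum (fun n => h n * (x * z) ^ n) (H (x * z)))
    (hsum : Summable fun n => ‖h n * z ^ n‖) :
    HasSum (fun n => h n * z ^ n / (β + n + 1))
      (∫ x in Set.Ioo (0 : ℝ) 1, ((x ^ β : ℝ) : ℂ) * H (x * z)) := by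
  have hpow : ∀ n : ℕ, -1 < β + n := fun n => by
    have : (0 : ℝ) ≤ n := n.cast_nonneg
    linarith
  have hterm : ∀ n : ℕ, ∀ x ∈ Set.Ioo (0 : ℝ) 1,
      ((x ^ β : ℝ) : ℂ) * (h n * (x * z) ^ n) = ((x ^ (β + n) : ℝ) : ℂ) * (h n * z ^ n) := by
    intro n x hx
    rw [Real.rpow_add hx.1, Real.rpow_natCast]
    push_cast
    ring
  have hF : ∀ n : ℕ, IntegrableOn (fun x : ℝ => ((x ^ β : ℝ) : ℂ) * (h n * (x * z) ^ n))
      (Set.Ioo 0 1) := by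
    intro n
    rw [integrableOn_congr_fun (hterm n) measurableSet_Ioo]
    exact (integrableOn_rpow_unit (hpow n)).ofReal.mul_const _
  have hnorm : ∀ n : ℕ, ∫ x in Set.Ioo (0 : ℝ) 1, ‖((x ^ β : ℝ) : ℂ) * (h n * (x * z) ^ n)‖ ≤
      ‖h n * z ^ n‖ * (1 / (β + 1)) := by
    intro n
    rw [← setIntegral_rpow_unit hβ, ← integral_const_mul]
    refine setIntegral_mono_on (hF n).norm ((integrableOn_rpow_unit hβ).const_mul _)
      measurableSet_Ioo fun x hx => ?_
    have hx0 := hx.1.le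
    rw [mul_pow, norm_mul, Complex.norm_real, Real.norm_of_nonneg (Real.rpow_nonneg hx0 β),
      mul_left_comm, norm_mul, norm_pow, Complex.norm_real, Real.norm_of_nonneg hx0,
      mul_comm _ (x ^ β)]
    refine mul_le_mul_of_nonneg_left ?_ (Real.rpow_nonneg hx0 β)
    exact mul_le_of_le_one_left (norm_nonneg _) (pow_le_one₀ hx0 hx.2.le)
  have key := hasSum_integral_of_summable_integral_norm hF
    (Summable.of_nonneg_of_le (fun n => integral_nonneg fun x => norm_nonneg _) hnorm
      (hsum.mul_right _))
  convert! key using 1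
  · ext n
    rw [setIntegral_congr_fun measurableSet_Ioo (hterm n), integral_mul_const, integral_complex_ofReal,
      setIntegral_rpow_unit (hpow n)]
    push_cast
    ring
  · refine setIntegral_congr_fun measurableSet_Ioo fun x hx => ?_
    exact ((hs x hx).mul_left _).tsum_eq.symm

/-- The function `(1 - w) ^ (-a)`, the Gauss series `₂F₁(a, b; b; w)`. -/
def binom (a w : ℂ) : ℂ := 1 / (1 - w) ^ a

lemma differentiableOn_binom (a : ℂ) : DifferentiableOn ℂ (binom a) cutPlane := by
  intro w hw
  have h0 : (1 - w) ^ a ≠ 0 := by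
    rw [Complex.cpow_def_of_ne_zero (Complex.slitPlane_ne_zero hw)]
    exact Complex.exp_ne_zero _
  have h1 : DifferentiableAt ℂ (fun w : ℂ => (1 - w) ^ a) w :=
    DifferentiableAt.cpow_const (by fun_prop) hw
  exact ((differentiableAt_const 1).div h1 h0).differentiableWithinAt

/-- The coefficients of the series of `(1 - w) ^ (-a)`. -/
def binomCoeff (a : ℂ) (n : ℕ) : ℂ := (n.factorial : ℂ)⁻¹ * (ascPochhammer ℂ n).eval a

lemma binomCoeff_eq_choose (a : ℂ) (n : ℕ) : binomCoeff a n = Ring.choose (a + n - 1) n := by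
  have h := Ring.factorial_nsmul_multichoose_eq_ascPochhammer a n
  rw [Polynomial.ascPochhammer_smeval_eq_eval, nsmul_eq_mul] at h
  rw [binomCoeff, ← Ring.multichoose_eq, ← h, inv_mul_cancel_left₀]
  exact_mod_cast n.factorial_ne_zero

lemma hasSum_binom (a : ℂ) {w : ℂ} (hw : ‖w‖ < 1) :
    HasSum (fun n => binomCoeff a n * w ^ n) (binom a w) := by
  have hmem : w ∈ Metric.eball (0 : ℂ) 1 := by
    simpa [Metric.mem_eball, edist_zero_right, ← ofReal_norm] using hw
  have := (Complex.one_div_one_sub_cpow_hasFPowerSeriesOnBall_zero a).hasSum hmem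
  simpa [FormalMultilinearSeries.ofScalars_apply_eq, binomCoeff_eq_choose, binom,
    mul_comm] using this

lemma summable_norm_binom (a : ℂ) {w : ℂ} (hw : ‖w‖ < 1) :
    Summable fun n => ‖binomCoeff a n * w ^ n‖ :=
  (hasSum_binom a hw).summable.norm

lemma ascPochhammer_eval_mul_add (b : ℂ) (n : ℕ) :
    (ascPochhammer ℂ n).eval b * (b + n) = b * (ascPochhammer ℂ n).eval (b + 1) := by
  induction n with
  | zero => simp
  | succ n ih =>
    rw [ascPochhammer_succ_eval, ascPochhammer_succ_eval, ih]
    push_cast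
    ring

lemma ascPochhammer_eval_ofReal_ne_zero {c : ℝ} (hc : 0 < c) (n : ℕ) :
    (ascPochhammer ℂ n).eval (c : ℂ) ≠ 0 := by
  induction n with
  | zero => simp
  | succ n ih =>
    rw [ascPochhammer_succ_eval]
    refine mul_ne_zero ih ?_
    have : c + n ≠ 0 := by positivity
    exact_mod_cast this

lemma ascPochhammer_ratio {b : ℝ} (hb : 0 < b + 1) {n : ℕ} (hn : b + n ≠ 0) :
    (ascPochhammer ℂ n).eval (b : ℂ) * ((ascPochhammer ℂ n).eval ((b + 1 : ℝ) : ℂ))⁻¹ =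
      b / (b + n) := by
  have h1 := ascPochhammer_eval_mul_add b n
  have h2 := ascPochhammer_eval_ofReal_ne_zero hb n
  have h3 : (b : ℂ) + n ≠ 0 := by exact_mod_cast hn
  push_cast at h2 ⊢
  rw [← div_eq_mul_inv, div_eq_div_iff h2 h3, h1]

/-- Euler's integral for `₂F₁(a, b; b + 1; z)`. -/
lemma isGaussContinuation_euler (a : ℂ) {b : ℝ} (hb : 0 < b) :
    IsGaussContinuation a b ((b + 1 : ℝ) : ℂ) fun z =>
      b * ∫ x in Set.Ioo (0 : ℝ) 1, ((x ^ (b - 1) : ℝ) : ℂ) * binom a (x * z) := by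
  refine ⟨(differentiableOn_integral_rpow_mul (differentiableOn_binom a)
    (by linarith)).const_mul _, fun z hz => ?_⟩
  have hz1 : ‖z‖ < 1 := by simpa using hz
  have hsum := (hasSum_integral_rpow_mul (H := binom a) (h := binomCoeff a) (z := z) (β := b - 1)
    (by linarith) (fun x hx => hasSum_binom a ?_) (summable_norm_binom a hz1)).mul_left (b : ℂ)
  · simp only
    rw [← hsum.tsum_eq, ordinaryHypergeometric_eq_tsum]
    refine tsum_congr fun n => ?_
    have hn : b + n ≠ 0 := by positivity
    rw [mul_assoc _ (Polynomial.eval (b : ℂ) _), ascPochhammer_ratio (by linarith) hn, smul_eq_mul,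
      binomCoeff]
    push_cast
    rw [show (b : ℂ) - 1 + n + 1 = b + n by ring]
    ring
  · rw [norm_mul, Complex.norm_real, Real.norm_of_nonneg hx.1.le]
    exact (mul_le_of_le_one_left (norm_nonneg _) hx.2.le).trans_lt hz1

/-- Euler's integral for `₂F₁(-δ, a; 1 - δ; z)` diverges at the origin; subtracting from
`(1 - w) ^ (-a)` its value at `w = 0` makes it converge. -/
lemma isGaussContinuation_euler_neg (a : ℂ) {δ : ℝ} (hδ1 : δ < 1) :
    IsGaussContinuation ((-δ : ℝ) : ℂ) a ((1 - δ : ℝ) : ℂ) fun z =>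
      1 - δ * (z * ∫ x in Set.Ioo (0 : ℝ) 1, ((x ^ (-δ) : ℝ) : ℂ) * dslope (binom a) 0 (x * z)) := by
  have h0 : cutPlane ∈ 𝓝 (0 : ℂ) := isOpen_cutPlane.mem_nhds (by simp [cutPlane])
  have hd := (Complex.differentiableOn_dslope h0).2 (differentiableOn_binom a)
  refine ⟨(differentiableOn_const 1).sub ((differentiableOn_id.mul
    (differentiableOn_integral_rpow_mul hd (by linarith))).const_mul _), fun z hz => ?_⟩
  have hz1 : ‖z‖ < 1 := by simpa using hz
  have hbinom0 : binom a 0 = 1 := by simp [binom]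
  rcases eq_or_ne z 0 with rfl | hz0
  · simp
  have hslope : ∀ w : ℂ, w ≠ 0 → ‖w‖ < 1 →
      HasSum (fun n => binomCoeff a (n + 1) * w ^ n) (dslope (binom a) 0 w) := by
    intro w hw0 hw1
    have h1 := (hasSum_nat_add_iff' 1).2 (hasSum_binom a hw1)
    have h2 := h1.mul_left w⁻¹
    rw [dslope_of_ne _ hw0, slope_def_field, hbinom0, sub_zero, div_eq_inv_mul]
    convert! h2 using 1
    · ext n
      rw [pow_succ]
      field_simp
    · simp [binomCoeff]
  have hsummable : Summable fun n => ‖binomCoeff a (n + 1) * z ^ n‖ :=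
    (hslope z hz0 hz1).summable.norm
  have hsum := hasSum_integral_rpow_mul (H := dslope (binom a) 0)
    (h := fun n => binomCoeff a (n + 1)) (z := z) (β := -δ)
    (by linarith) (fun x hx => hslope _ (mul_ne_zero (by exact_mod_cast hx.1.ne') hz0) ?_) hsummable
  · have hsum' := (hsum.mul_left z).mul_left (-δ : ℂ)
    have hsum2 : HasSum (fun n => (((n.factorial : ℂ)⁻¹ * (ascPochhammer ℂ n).eval ((-δ : ℝ) : ℂ) *
        (ascPochhammer ℂ n).eval a * ((ascPochhammer ℂ n).eval ((1 - δ : ℝ) : ℂ))⁻¹) • z ^ n))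
        (1 - δ * (z * ∫ x in Set.Ioo (0 : ℝ) 1, ((x ^ (-δ) : ℝ) : ℂ) *
          dslope (binom a) 0 (x * z))) := by
      rw [← hasSum_nat_add_iff' 1]
      convert! hsum' using 1
      · ext n
        have hn : -δ + ((n + 1 : ℕ) : ℝ) ≠ 0 := by
          have : (0 : ℝ) ≤ n := n.cast_nonneg
          push_cast
          linarith
        have hr := ascPochhammer_ratio (b := -δ) (by linarith) hn
        rw [show -δ + 1 = 1 - δ by ring] at hr
        rw [mul_right_comm _ _ (Polynomial.eval a _), mul_assoc, hr, smul_eq_mul, binomCoeff]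
        push_cast
        rw [pow_succ, ← add_assoc]
        ring
      · simp
    rw [ordinaryHypergeometric_eq_tsum]
    exact hsum2.tsum_eq.symm
  · rw [norm_mul, Complex.norm_real, Real.norm_of_nonneg hx.1.le]
    exact (mul_le_of_le_one_left (norm_nonneg _) hx.2.le).trans_lt hz1

lemma binom_ofReal {a v : ℝ} (hv : 0 ≤ v) :
    binom a ((-v : ℝ) : ℂ) = (((1 + v) ^ (-a) : ℝ) : ℂ) := by
  rw [binom, Real.rpow_neg (by linarith), Complex.ofReal_inv, Complex.ofReal_cpow (by linarith)]
  push_cast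
  rw [sub_neg_eq_add, one_div]

lemma rhoL_eq {p : Params} (hαL : 0 < p.αL) (hNL : 0 < p.NL) {v : ℝ} (hv : 0 ≤ v) :
    rhoL p v = 2 / p.αL * (v ^ p.NL *
      ∫ x in Set.Ioo (0 : ℝ) 1, x ^ (p.NL + 2 / p.αL - 1) * (1 + x * v) ^ (-p.NL)) := by
  have hb : 0 < p.NL + 2 / p.αL := by positivity
  rw [rhoL, gaussF_eq (isGaussContinuation_euler p.NL hb) (neg_ofReal_mem_cutPlane hv)]
  have h1 : ∫ x in Set.Ioo (0 : ℝ) 1, ((x ^ (p.NL + 2 / p.αL - 1) : ℝ) : ℂ) *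
      binom p.NL (x * ((-v : ℝ) : ℂ)) = ((∫ x in Set.Ioo (0 : ℝ) 1,
        x ^ (p.NL + 2 / p.αL - 1) * (1 + x * v) ^ (-p.NL) : ℝ) : ℂ) := by
    rw [← integral_complex_ofReal]
    refine setIntegral_congr_fun measurableSet_Ioo fun x hx => ?_
    rw [← Complex.ofReal_mul, mul_neg, binom_ofReal (mul_nonneg hx.1.le hv)]
    push_cast
    rfl
  rw [h1, ← Complex.ofReal_mul, Complex.ofReal_re]
  generalize ∫ x in Set.Ioo (0 : ℝ) 1,
    x ^ (p.NL + 2 / p.αL - 1) * (1 + x * v) ^ (-p.NL) = J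
  field_simp

lemma rhoN_eq {p : Params} (hαN : 2 < p.αN) {v : ℝ} (hv : 0 ≤ v) :
    rhoN p v = 1 + 2 / p.αN *
      ∫ x in Set.Ioo (0 : ℝ) 1, x ^ (-(2 / p.αN) - 1) * (1 - (1 + x * v) ^ (-p.NN)) := by
  have hδ1 : 2 / p.αN < 1 := (div_lt_one (by linarith)).2 hαN
  rw [rhoN, gaussF_eq (isGaussContinuation_euler_neg p.NN hδ1) (neg_ofReal_mem_cutPlane hv)]
  have h1 : ((-v : ℝ) : ℂ) * ∫ x in Set.Ioo (0 : ℝ) 1, ((x ^ (-(2 / p.αN)) : ℝ) : ℂ) *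
      dslope (binom p.NN) 0 (x * ((-v : ℝ) : ℂ)) = ((∫ x in Set.Ioo (0 : ℝ) 1,
        x ^ (-(2 / p.αN) - 1) * ((1 + x * v) ^ (-p.NN) - 1) : ℝ) : ℂ) := by
    rw [← integral_complex_ofReal, ← integral_const_mul]
    refine setIntegral_congr_fun measurableSet_Ioo fun x hx => ?_
    have h2 := sub_smul_dslope (binom p.NN) 0 (x * ((-v : ℝ) : ℂ))
    rw [sub_zero, smul_eq_mul, ← Complex.ofReal_mul, mul_neg, binom_ofReal (mul_nonneg hx.1.le hv),
      show binom p.NN 0 = 1 by simp [binom]] at h2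
    rw [Real.rpow_sub_one hx.1.ne', ← Complex.ofReal_mul, mul_neg]
    push_cast at h2 ⊢
    rw [div_mul_eq_mul_div, ← h2]
    have hx0 : (x : ℂ) ≠ 0 := by exact_mod_cast hx.1.ne'
    field_simp
  rw [h1]
  have h3 : ∫ x in Set.Ioo (0 : ℝ) 1, x ^ (-(2 / p.αN) - 1) * ((1 + x * v) ^ (-p.NN) - 1) =
      -∫ x in Set.Ioo (0 : ℝ) 1, x ^ (-(2 / p.αN) - 1) * (1 - (1 + x * v) ^ (-p.NN)) := by
    rw [← integral_neg]
    congr 1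
    ext x
    ring
  rw [h3, ← Complex.ofReal_mul, ← Complex.ofReal_one, ← Complex.ofReal_sub, Complex.ofReal_re]
  ring

/-! ### The Laplace transform of the power of one link -/

/-- The standing assumptions on the parameters. -/
structure Admissible (p : Params) : Prop where
  dens : 0 < p.dens
  RL : 0 < p.RL
  CL : 0 < p.CL
  CN : 0 < p.CN
  αL : 0 < p.αL
  αN : 2 < p.αN
  NL : 0 < p.NL
  NN : 0 < p.NN
  M : 1 ≤ p.M
  q : 0 < p.q
  wl : 0 < p.wl

/-- The power `|g|²` of a Nakagami amplitude has a Gamma distribution. -/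
lemma lintegral_nakagami {m t : ℝ} (hm : 0 < m) (ht : 0 ≤ t) :
    ∫⁻ x, ENNReal.ofReal (Real.exp (-(t * x ^ 2))) ∂nakagami m =
      ENNReal.ofReal ((1 + t / m) ^ (-m)) := by
  have hb : 0 < m + t := by linarith
  have hΓ : 0 < Real.Gamma m := Real.Gamma_pos_of_pos hm
  set c := 2 * m ^ m / Real.Gamma m
  have hc : 0 ≤ c := by positivity
  have hcongr : ∀ x ∈ Set.Ioi (0 : ℝ),
      ENNReal.ofReal (c * x ^ (2 * m - 1) * Real.exp (-(m * x ^ 2))) *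
        ENNReal.ofReal (Real.exp (-(t * x ^ 2))) =
      ENNReal.ofReal (c * (x ^ (2 * m - 1) * Real.exp (-(m + t) * x ^ (2 : ℝ)))) := by
    intro x hx
    have hx0 : 0 ≤ x := le_of_lt hx
    rw [← ENNReal.ofReal_mul (by positivity), mul_assoc, mul_assoc, ← Real.exp_add, Real.rpow_two]
    ring_nf
  have hint := (integrableOn_rpow_mul_exp_neg_mul_rpow (p := 2) (s := 2 * m - 1) (by linarith)
    (by norm_num) hb).const_mul c
  rw [nakagami, lintegral_withDensity_eq_lintegral_mul _ (by fun_prop) (by fun_prop)]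
  simp only [Pi.mul_apply]
  rw [setLIntegral_congr_fun measurableSet_Ioi hcongr, ← ofReal_integral_eq_lintegral_ofReal hint,
    integral_const_mul, integral_rpow_mul_exp_neg_mul_rpow (by norm_num) (by linarith) hb]
  · congr 1
    rw [show -(2 * m - 1 + 1) / 2 = -m by ring, show (2 * m - 1 + 1) / 2 = m by ring,
      show 1 + t / m = (m + t) / m by field_simp, Real.div_rpow hb.le hm.le,
      Real.rpow_neg hm.le, Real.rpow_neg hb.le]
    simp only [c]
    field_simp
  · filter_upwards [ae_restrict_mem measurableSet_Ioi] with x hx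
    have hx0 : 0 ≤ x := le_of_lt hx
    exact mul_nonneg hc (mul_nonneg (Real.rpow_nonneg hx0 _) (Real.exp_pos _).le)

lemma isProbabilityMeasure_nakagami {m : ℝ} (hm : 0 < m) : IsProbabilityMeasure (nakagami m) := by
  constructor
  simpa using lintegral_nakagami hm le_rfl

lemma volume_angle_interval {p : Params} (hp : Admissible p) :
    volume (Set.Icc (-(p.q / p.wl)) (p.q / p.wl)) ≠ 0 := by
  have := div_pos hp.q hp.wl
  rw [Real.volume_Icc]
  simp
  linarith

lemma isProbabilityMeasure_angleLaw {p : Params} (hp : Admissible p) :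
    IsProbabilityMeasure (angleLaw p) :=
  ProbabilityTheory.cond_isProbabilityMeasure_of_finite (volume_angle_interval hp)
    isCompact_Icc.measure_lt_top.ne

/-- The Laplace transform of the power received over a link of length `r`, averaged over the
fading only; `a` is `s` times the gain of the antenna. -/
def fadingLaplace (p : Params) (a r : ℝ) : ℝ :=
  if r ≤ p.RL then (1 + a * (p.CL * r ^ (-p.αL)) / p.NL) ^ (-p.NL)
  else (1 + a * (p.CN * r ^ (-p.αN)) / p.NN) ^ (-p.NN)

lemma measurable_fadingLaplace (p : Params) :
    Measurable fun q : ℝ × ℝ => fadingLaplace p q.1 q.2 := by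
  unfold fadingLaplace
  refine Measurable.ite (measurableSet_le measurable_snd measurable_const) ?_ ?_ <;> fun_prop

lemma fadingLaplace_nonneg {p : Params} (hp : Admissible p) {a r : ℝ} (ha : 0 ≤ a) (hr : 0 ≤ r) :
    0 ≤ fadingLaplace p a r := by
  have := hp.CL
  have := hp.CN
  have := hp.NL
  have := hp.NN
  unfold fadingLaplace
  split_ifs <;> positivity

lemma fadingLaplace_le_one {p : Params} (hp : Admissible p) {a r : ℝ} (ha : 0 ≤ a) (hr : 0 ≤ r) :
    fadingLaplace p a r ≤ 1 := by
  have := hp.CL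
  have := hp.CN
  have hL := hp.NL
  have hN := hp.NN
  unfold fadingLaplace
  split_ifs
  · exact Real.rpow_le_one_of_one_le_of_nonpos (le_add_of_nonneg_right (by positivity))
      (by linarith)
  · exact Real.rpow_le_one_of_one_le_of_nonpos (le_add_of_nonneg_right (by positivity))
      (by linarith)

lemma linkLaplace_eq {p : Params} (hp : Admissible p) {s r : ℝ} (hs : 0 ≤ s) (hr : 0 ≤ r) :
    linkLaplace p s r =
      ∫⁻ t, ENNReal.ofReal (fadingLaplace p (s * (p.M * fejer p.M t)) r) ∂angleLaw p := by
  have := isProbabilityMeasure_nakagami hp.NL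
  have := isProbabilityMeasure_nakagami hp.NN
  have := isProbabilityMeasure_angleLaw hp
  have hpath : 0 ≤ pathLoss p r := by
    have := hp.CL
    have := hp.CN
    unfold pathLoss
    split_ifs <;> positivity
  have hm : Measurable fun l => negExp (ENNReal.ofReal s * ENNReal.ofReal (linkPower p l r)) := by
    have := (measurable_linkPower hp.M).comp (measurable_prodMk_right (y := r))
    simp only [Function.comp_def] at this
    fun_prop
  have hval : ∀ l, negExp (ENNReal.ofReal s * ENNReal.ofReal (linkPower p l r)) =
      ENNReal.ofReal (Real.exp (-((s * (p.M * fejer p.M l.2.2) * pathLoss p r) *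
        (if r ≤ p.RL then l.1 else l.2.1) ^ 2))) := by
    intro l
    have := fejer_nonneg p.M l.2.2
    have hpow : 0 ≤ linkPower p l r := by
      unfold linkPower
      positivity
    rw [← ENNReal.ofReal_mul hs, negExp_ofReal (by positivity), linkPower]
    congr 3
    ring
  have hcoef : ∀ t, 0 ≤ s * (p.M * fejer p.M t) * pathLoss p r := fun t => by
    have := fejer_nonneg p.M t
    positivity
  have hm2 : ∀ x, Measurable fun y : ℝ × ℝ =>
      negExp (ENNReal.ofReal s * ENNReal.ofReal (linkPower p (x, y) r)) := fun x =>
    hm.comp measurable_prodMk_left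
  unfold linkLaplace linkLaw
  rw [lintegral_prod _ hm.aemeasurable]
  by_cases hrL : r ≤ p.RL
  · have h1 : ∀ x, ∫⁻ y, negExp (ENNReal.ofReal s * ENNReal.ofReal (linkPower p (x, y) r))
        ∂((nakagami p.NN).prod (angleLaw p)) = ∫⁻ t, ENNReal.ofReal (Real.exp
          (-((s * (p.M * fejer p.M t) * pathLoss p r) * x ^ 2))) ∂angleLaw p := by
      intro x
      rw [lintegral_prod _ (hm2 x).aemeasurable]
      simp [hval, hrL]
    simp_rw [h1]
    rw [lintegral_lintegral_swap]
    · refine lintegral_congr fun t => ?_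
      rw [lintegral_nakagami hp.NL (hcoef t)]
      simp [fadingLaplace, pathLoss, hrL]
    · have := (continuous_fejer hp.M).measurable
      fun_prop
  · have h1 : ∀ x, ∫⁻ y, negExp (ENNReal.ofReal s * ENNReal.ofReal (linkPower p (x, y) r))
        ∂((nakagami p.NN).prod (angleLaw p)) =
          ∫⁻ t, ENNReal.ofReal (fadingLaplace p (s * (p.M * fejer p.M t)) r) ∂angleLaw p := by
      intro x
      rw [lintegral_prod_symm' _ (hm2 x)]
      refine lintegral_congr fun t => ?_
      simp only [hval, hrL, if_false]
      rw [lintegral_nakagami hp.NN (hcoef t)]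
      simp [fadingLaplace, pathLoss, hrL]
    simp_rw [h1]
    simp

/-! ### Integration over the plane -/

/-- The integral of `1 - fadingLaplace` over the plane, in polar coordinates and up to the
factor `2 π`. -/
def radialIntegral (p : Params) (a : ℝ) : ℝ :=
  ∫ r in Set.Ioi (0 : ℝ), r * (1 - fadingLaplace p a r)

/-- Bernoulli's inequality for negative exponents. -/
lemma one_sub_rpow_neg_le {y m : ℝ} (hy : 0 ≤ y) (hm : 0 ≤ m) :
    1 - (1 + y) ^ (-m) ≤ m * y := by
  have h1 : (0 : ℝ) < 1 + y := by linarith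
  rw [Real.rpow_def_of_pos h1]
  have h2 := Real.add_one_le_exp (Real.log (1 + y) * -m)
  have h3 : Real.log (1 + y) ≤ y := by linarith [Real.log_le_sub_one_of_pos h1]
  nlinarith [mul_le_mul_of_nonneg_right h3 hm]

/-- An integrable majorant of `r * (1 - fadingLaplace p a r)` for `a ≤ A`. -/
def radialBound (p : Params) (A r : ℝ) : ℝ :=
  (Set.Ioc 0 p.RL).indicator id r + (Set.Ioi p.RL).indicator (fun r => A * p.CN * r ^ (1 - p.αN)) r

lemma integrable_radialBound {p : Params} (hp : Admissible p) (A : ℝ) :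
    Integrable (radialBound p A) := by
  refine Integrable.add ?_ ?_
  · rw [integrable_indicator_iff measurableSet_Ioc]
    exact continuous_id.integrableOn_Ioc
  · rw [integrable_indicator_iff measurableSet_Ioi]
    exact (integrableOn_Ioi_rpow_of_lt (by linarith [hp.αN]) hp.RL).const_mul _

lemma radial_nonneg {p : Params} (hp : Admissible p) {a r : ℝ} (ha : 0 ≤ a) (hr : 0 < r) :
    0 ≤ r * (1 - fadingLaplace p a r) :=
  mul_nonneg hr.le (sub_nonneg.2 (fadingLaplace_le_one hp ha hr.le))

lemma radial_le_radialBound {p : Params} (hp : Admissible p) {a A r : ℝ} (ha : 0 ≤ a)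
    (haA : a ≤ A) (hr : 0 < r) : r * (1 - fadingLaplace p a r) ≤ radialBound p A r := by
  have hCN := hp.CN
  have hNN := hp.NN
  by_cases hrL : r ≤ p.RL
  · have h1 : radialBound p A r = r := by
      rw [radialBound, Set.indicator_of_mem (show r ∈ Set.Ioc 0 p.RL from ⟨hr, hrL⟩),
        Set.indicator_of_notMem (by simpa using hrL)]
      simp
    rw [h1]
    exact mul_le_of_le_one_right hr.le (by linarith [fadingLaplace_nonneg hp ha hr.le])
  · have h1 : radialBound p A r = A * p.CN * r ^ (1 - p.αN) := by
      rw [radialBound, Set.indicator_of_notMem (fun h => hrL h.2),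
        Set.indicator_of_mem (by simpa using hrL)]
      simp
    have h2 := one_sub_rpow_neg_le (y := a * (p.CN * r ^ (-p.αN)) / p.NN) (by positivity) hNN.le
    rw [mul_div_cancel₀ _ hNN.ne'] at h2
    rw [h1, fadingLaplace, if_neg hrL, sub_eq_add_neg 1 p.αN, Real.rpow_add hr, Real.rpow_one]
    calc r * (1 - (1 + a * (p.CN * r ^ (-p.αN)) / p.NN) ^ (-p.NN))
        ≤ r * (a * (p.CN * r ^ (-p.αN))) := by gcongr
      _ ≤ r * (A * (p.CN * r ^ (-p.αN))) := by gcongr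
      _ = _ := by ring

lemma measurable_radial (p : Params) (a : ℝ) :
    Measurable fun r => r * (1 - fadingLaplace p a r) := by
  have := (measurable_fadingLaplace p).comp (measurable_prodMk_left (x := a))
  simp only [Function.comp_def] at this
  fun_prop

lemma norm_radial_le {p : Params} (hp : Admissible p) {a A : ℝ} (ha : 0 ≤ a) (haA : a ≤ A) :
    ∀ᵐ r ∂(volume.restrict (Set.Ioi (0 : ℝ))),
      ‖r * (1 - fadingLaplace p a r)‖ ≤ radialBound p A r := by
  filter_upwards [ae_restrict_mem measurableSet_Ioi] with r hr
  rw [Real.norm_of_nonneg (radial_nonneg hp ha hr)]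
  exact radial_le_radialBound hp ha haA hr

lemma integrableOn_radial {p : Params} (hp : Admissible p) {a : ℝ} (ha : 0 ≤ a) :
    IntegrableOn (fun r => r * (1 - fadingLaplace p a r)) (Set.Ioi 0) :=
  Integrable.mono' (integrable_radialBound hp a).integrableOn
    (measurable_radial p a).aestronglyMeasurable (norm_radial_le hp ha le_rfl)

lemma radialIntegral_nonneg {p : Params} (hp : Admissible p) {a : ℝ} (ha : 0 ≤ a) :
    0 ≤ radialIntegral p a :=
  setIntegral_nonneg measurableSet_Ioi fun _ hr => radial_nonneg hp ha hr

lemma continuous_radialIntegral {p : Params} (hp : Admissible p) {f : ℝ → ℝ} (hf : Continuous f)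
    {A : ℝ} (hf0 : ∀ t, 0 ≤ f t) (hfA : ∀ t, f t ≤ A) :
    Continuous fun t => radialIntegral p (f t) := by
  refine continuous_of_dominated (bound := radialBound p A)
    (fun t => (measurable_radial p _).aestronglyMeasurable)
    (fun t => norm_radial_le hp (hf0 t) (hfA t)) (integrable_radialBound hp A).integrableOn ?_
  filter_upwards [ae_restrict_mem measurableSet_Ioi] with r hr
  have hr0 : 0 < r := hr
  have := hp.CL
  have := hp.CN
  have := hp.NL
  have := hp.NN
  unfold fadingLaplace
  split_ifs
  all_goals
    refine continuous_const.mul (continuous_const.sub (Continuous.rpow_const (by fun_prop)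
      fun t => Or.inl ?_))
    have := hf0 t
    positivity

lemma lintegral_one_sub_fadingLaplace {p : Params} (hp : Admissible p) {a : ℝ} (ha : 0 ≤ a) :
    ∫⁻ z : Plane, ENNReal.ofReal (1 - fadingLaplace p a ‖z‖) =
      ENNReal.ofReal (2 * Real.pi * radialIntegral p a) := by
  have hfin : Module.finrank ℝ Plane = 2 := by simp
  have hint : Integrable fun z : Plane => 1 - fadingLaplace p a ‖z‖ := by
    rw [integrable_fun_norm_addHaar volume (f := fun r => 1 - fadingLaplace p a r), hfin]
    simpa using integrableOn_radial hp ha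
  rw [← ofReal_integral_eq_lintegral_ofReal hint (ae_of_all _ fun z =>
      sub_nonneg.2 (fadingLaplace_le_one hp ha (norm_nonneg _))),
    integral_fun_norm_addHaar volume fun r => 1 - fadingLaplace p a r, hfin]
  congr 1
  have hball : (volume : Measure Plane).real (Metric.ball 0 1) = Real.pi := by
    rw [measureReal_def, EuclideanSpace.volume_ball_fin_two]
    simp [Real.pi_pos.le]
  rw [hball, radialIntegral]
  simp
  ring

/-- By Tonelli, the average over the angle is taken after the integration over the plane. -/
lemma lintegral_one_sub_linkLaplace {p : Params} (hp : Admissible p) {s : ℝ} (hs : 0 ≤ s) :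
    ∫⁻ z : Plane, (1 - linkLaplace p s ‖z‖) =
      ENNReal.ofReal (∫ t, 2 * Real.pi * radialIntegral p (s * (p.M * fejer p.M t))
        ∂angleLaw p) := by
  have := isProbabilityMeasure_angleLaw hp
  obtain ⟨a, ha_eq⟩ : ∃ a : ℝ → ℝ, ∀ t, a t = s * (p.M * fejer p.M t) := ⟨_, fun _ => rfl⟩
  have ha : ∀ t, 0 ≤ a t := fun t => by
    have := fejer_nonneg p.M t
    rw [ha_eq]
    positivity
  have haA : ∀ t, a t ≤ s * p.M := fun t => by
    rw [ha_eq]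
    gcongr
    exact mul_le_of_le_one_right (by positivity) (fejer_le_one p.M t)
  have hac : Continuous a := by
    rw [show a = _ from funext ha_eq]
    have := continuous_fejer hp.M
    fun_prop
  have hlap : ∀ z : Plane, linkLaplace p s ‖z‖ =
      ∫⁻ t, ENNReal.ofReal (fadingLaplace p (a t) ‖z‖) ∂angleLaw p := fun z => by
    simp_rw [ha_eq]
    exact linkLaplace_eq hp hs (norm_nonneg z)
  have hmeas : Measurable fun q : Plane × ℝ => fadingLaplace p (a q.2) ‖q.1‖ :=
    (measurable_fadingLaplace p).comp
      ((hac.measurable.comp measurable_snd).prodMk measurable_fst.norm)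
  simp_rw [← ha_eq]
  have h1 : ∀ z : Plane, 1 - linkLaplace p s ‖z‖ =
      ∫⁻ t, ENNReal.ofReal (1 - fadingLaplace p (a t) ‖z‖) ∂angleLaw p := by
    intro z
    have hmz : Measurable fun t => fadingLaplace p (a t) ‖z‖ :=
      (measurable_fadingLaplace p).comp (hac.measurable.prodMk measurable_const)
    have hadd : ∫⁻ t, ENNReal.ofReal (1 - fadingLaplace p (a t) ‖z‖) ∂angleLaw p
        + linkLaplace p s ‖z‖ = 1 := by
      rw [hlap z,
        ← lintegral_add_left (hmz.const_sub 1).ennreal_ofReal]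
      have : ∀ t, ENNReal.ofReal (1 - fadingLaplace p (a t) ‖z‖) +
          ENNReal.ofReal (fadingLaplace p (a t) ‖z‖) = 1 := by
        intro t
        rw [← ENNReal.ofReal_add
          (sub_nonneg.2 (fadingLaplace_le_one hp (ha t) (norm_nonneg z)))
          (fadingLaplace_nonneg hp (ha t) (norm_nonneg z))]
        simp
      simp [this]
    have hle : linkLaplace p s ‖z‖ ≤ 1 := le_add_self.trans_eq hadd
    exact (ENNReal.eq_sub_of_add_eq (ne_top_of_le_ne_top ENNReal.one_ne_top hle) hadd).symm
  simp_rw [h1]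
  rw [lintegral_lintegral_swap (hmeas.const_sub 1).ennreal_ofReal.aemeasurable]
  simp_rw [fun t => lintegral_one_sub_fadingLaplace hp (ha t)]
  have hcont := continuous_radialIntegral hp hac ha haA
  rw [← ofReal_integral_eq_lintegral_ofReal]
  · refine Integrable.mono'
      (g := fun _ => 2 * Real.pi * ∫ r in Set.Ioi 0, radialBound p (s * p.M) r)
      (integrable_const _) (continuous_const.mul hcont).aestronglyMeasurable (ae_of_all _ fun t => ?_)
    have h2 := radialIntegral_nonneg hp (ha t)
    rw [Real.norm_of_nonneg (by positivity)]
    gcongr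
    refine integral_mono_ae (integrableOn_radial hp (ha t))
      (integrable_radialBound hp _).integrableOn ?_
    filter_upwards [ae_restrict_mem measurableSet_Ioi] with r hr
    exact radial_le_radialBound hp (ha t) (haA t) hr
  · refine ae_of_all _ fun t => ?_
    have h2 := radialIntegral_nonneg hp (ha t)
    exact mul_nonneg (by positivity) h2

/-! ### The closed form of the radial integral -/

lemma integral_Ioi_comp_mul_rpow (g : ℝ → ℝ) {R β : ℝ} (hR : 0 < R) (hβ : β ≠ 0) :
    ∫ r in Set.Ioi 0, g r = ∫ x in Set.Ioi 0, R * (|β| * x ^ (β - 1)) * g (R * x ^ β) := by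
  have h1 := integral_comp_mul_left_Ioi g 0 hR
  rw [mul_zero, smul_eq_mul, eq_inv_mul_iff_mul_eq₀ hR.ne'] at h1
  rw [← h1, ← integral_comp_rpow_Ioi _ hβ, ← integral_const_mul]
  simp only [smul_eq_mul, mul_assoc]

/-- The substitution `r = R * x ^ β` on `(0, R]`. -/
lemma integral_Ioc_comp_mul_rpow (g : ℝ → ℝ) {R β : ℝ} (hR : 0 < R) (hβ : 0 < β) :
    ∫ r in Set.Ioc 0 R, g r =
      ∫ x in Set.Ioo (0 : ℝ) 1, R * (β * x ^ (β - 1)) * g (R * x ^ β) := by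
  rw [← Set.Ioi_inter_Iic, ← setIntegral_indicator measurableSet_Iic,
    integral_Ioi_comp_mul_rpow _ hR hβ.ne', ← integral_Ioc_eq_integral_Ioo, ← Set.Ioi_inter_Iic,
    ← setIntegral_indicator measurableSet_Iic]
  refine setIntegral_congr_fun measurableSet_Ioi fun x hx => ?_
  have hx0 : 0 < x := hx
  have hiff : R * x ^ β ≤ R ↔ x ≤ 1 := by
    rw [mul_le_iff_le_one_right hR, Real.rpow_le_one_iff_of_pos hx0]
    constructor
    · rintro (h | h)
      · linarith [h.2]
      · exact h.1
    · exact fun h => Or.inr ⟨h, hβ.le⟩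
  simp only [Set.indicator, Set.mem_Iic, hiff, abs_of_pos hβ]
  split_ifs <;> simp

/-- The substitution `r = R * x ^ (-β)` on `(R, ∞)`. -/
lemma integral_Ioi_comp_mul_rpow_neg (g : ℝ → ℝ) {R β : ℝ} (hR : 0 < R) (hβ : 0 < β) :
    ∫ r in Set.Ioi R, g r =
      ∫ x in Set.Ioo (0 : ℝ) 1, R * (β * x ^ (-β - 1)) * g (R * x ^ (-β)) := by
  have h1 : Set.Ioi R = Set.Ioi 0 ∩ Set.Ioi R := by
    rw [Set.Ioi_inter_Ioi, sup_of_le_right hR.le]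
  rw [h1, ← setIntegral_indicator measurableSet_Ioi,
    integral_Ioi_comp_mul_rpow _ hR (neg_ne_zero.2 hβ.ne'), ← Set.Ioi_inter_Iio,
    ← setIntegral_indicator measurableSet_Iio]
  refine setIntegral_congr_fun measurableSet_Ioi fun x hx => ?_
  have hx0 : 0 < x := hx
  have hiff : R < R * x ^ (-β) ↔ x < 1 := by
    rw [lt_mul_iff_one_lt_right hR, Real.one_lt_rpow_iff_of_pos hx0]
    constructor
    · rintro (h | h)
      · linarith [h.2]
      · exact h.1
    · exact fun h => Or.inr ⟨h, by linarith⟩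
  simp only [Set.indicator, Set.mem_Ioi, Set.mem_Iio, hiff, abs_neg, abs_of_pos hβ]
  split_ifs <;> simp

lemma integral_LOS {p : Params} (hp : Admissible p) {a : ℝ} (ha : 0 < a) :
    ∫ r in Set.Ioc 0 p.RL, r * (1 + a * (p.CL * r ^ (-p.αL)) / p.NL) ^ (-p.NL) =
      p.RL ^ 2 / 2 * rhoL p (p.NL * p.RL ^ p.αL / (a * p.CL)) := by
  have hα := hp.αL
  have hN := hp.NL
  have hR := hp.RL
  have hC := hp.CL
  set v := p.NL * p.RL ^ p.αL / (a * p.CL)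
  have hv : 0 < v := by positivity
  rw [rhoL_eq hα hN hv.le, integral_Ioc_comp_mul_rpow _ hR (one_div_pos.2 hα),
    ← mul_assoc, ← mul_assoc, ← integral_const_mul]
  refine setIntegral_congr_fun measurableSet_Ioo fun x hx => ?_
  have hx0 : 0 < x := hx.1
  have h1 : (p.RL * x ^ (1 / p.αL)) ^ (-p.αL) = p.RL ^ (-p.αL) * x⁻¹ := by
    rw [Real.mul_rpow hR.le (Real.rpow_nonneg hx0.le _), ← Real.rpow_mul hx0.le,
      show 1 / p.αL * -p.αL = -1 by field_simp, Real.rpow_neg_one]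
  have h2 : 1 + a * (p.CL * (p.RL ^ (-p.αL) * x⁻¹)) / p.NL = (1 + x * v) / (v * x) := by
    simp only [v]
    rw [Real.rpow_neg hR.le]
    have : 0 < p.RL ^ p.αL := Real.rpow_pos_of_pos hR _
    field_simp
    ring
  have h3 : x ^ (p.NL + 2 / p.αL - 1) = x ^ (1 / p.αL - 1) * x ^ (1 / p.αL) * x ^ p.NL := by
    rw [← Real.rpow_add hx0, ← Real.rpow_add hx0]
    congr 1
    ring
  rw [h1, h2, h3, Real.div_rpow (by positivity) (by positivity), Real.rpow_neg (by positivity : 0 ≤ v * x),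
    div_inv_eq_mul, Real.mul_rpow hv.le hx0.le]
  field_simp

lemma integral_NLOS {p : Params} (hp : Admissible p) {a : ℝ} (ha : 0 < a) :
    ∫ r in Set.Ioi p.RL, r * (1 - (1 + a * (p.CN * r ^ (-p.αN)) / p.NN) ^ (-p.NN)) =
      p.RL ^ 2 / 2 * (rhoN p (a * p.CN / (p.NN * p.RL ^ p.αN)) - 1) := by
  have hα : 0 < p.αN := by linarith [hp.αN]
  have hN := hp.NN
  have hR := hp.RL
  have hC := hp.CN
  set w := a * p.CN / (p.NN * p.RL ^ p.αN)
  have hw : 0 < w := by positivity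
  rw [rhoN_eq hp.αN hw.le, integral_Ioi_comp_mul_rpow_neg _ hR (one_div_pos.2 hα),
    add_sub_cancel_left, ← mul_assoc, ← integral_const_mul]
  refine setIntegral_congr_fun measurableSet_Ioo fun x hx => ?_
  have hx0 : 0 < x := hx.1
  have h1 : (p.RL * x ^ (-(1 / p.αN))) ^ (-p.αN) = p.RL ^ (-p.αN) * x := by
    rw [Real.mul_rpow hR.le (Real.rpow_nonneg hx0.le _), ← Real.rpow_mul hx0.le,
      show -(1 / p.αN) * -p.αN = 1 by field_simp, Real.rpow_one]
  have h2 : 1 + a * (p.CN * (p.RL ^ (-p.αN) * x)) / p.NN = 1 + x * w := by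
    simp only [w]
    rw [Real.rpow_neg hR.le]
    have : 0 < p.RL ^ p.αN := Real.rpow_pos_of_pos hR _
    field_simp
  have h3 : x ^ (-(2 / p.αN) - 1) = x ^ (-(1 / p.αN) - 1) * x ^ (-(1 / p.αN)) := by
    rw [← Real.rpow_add hx0]
    congr 1
    ring
  rw [h1, h2, h3]
  field_simp

lemma radialIntegral_eq {p : Params} (hp : Admissible p) {a : ℝ} (ha : 0 < a) :
    radialIntegral p a = p.RL ^ 2 / 2 * (rhoN p (a * p.CN / (p.NN * p.RL ^ p.αN)) -
      rhoL p (p.NL * p.RL ^ p.αL / (a * p.CL))) := by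
  have hint := integrableOn_radial hp ha.le
  have hsub1 : Set.Ioc 0 p.RL ⊆ Set.Ioi 0 := fun r hr => hr.1
  have hsub2 : Set.Ioi p.RL ⊆ Set.Ioi 0 := fun r hr => hp.RL.trans hr
  have hid : IntegrableOn (fun r : ℝ => r) (Set.Ioc 0 p.RL) := continuous_id.integrableOn_Ioc
  have h1 : ∫ r in Set.Ioc 0 p.RL, r * (1 - fadingLaplace p a r) = p.RL ^ 2 / 2 -
      ∫ r in Set.Ioc 0 p.RL, r * (1 + a * (p.CL * r ^ (-p.αL)) / p.NL) ^ (-p.NL) := by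
    have h2 : ∫ r in Set.Ioc 0 p.RL, r = p.RL ^ 2 / 2 := by
      rw [← intervalIntegral.integral_of_le hp.RL.le, integral_id]
      ring
    have h3 : ∀ r ∈ Set.Ioc 0 p.RL, r * (1 + a * (p.CL * r ^ (-p.αL)) / p.NL) ^ (-p.NL) =
        r - r * (1 - fadingLaplace p a r) := fun r hr => by
      rw [fadingLaplace, if_pos hr.2]
      ring
    rw [setIntegral_congr_fun measurableSet_Ioc h3, integral_sub hid (hint.mono_set hsub1), h2]
    ring
  have h4 : ∫ r in Set.Ioi p.RL, r * (1 - fadingLaplace p a r) =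
      ∫ r in Set.Ioi p.RL, r * (1 - (1 + a * (p.CN * r ^ (-p.αN)) / p.NN) ^ (-p.NN)) :=
    setIntegral_congr_fun measurableSet_Ioi fun r hr => by
      rw [fadingLaplace, if_neg (not_le.2 hr)]
  rw [radialIntegral, ← Set.Ioc_union_Ioi_eq_Ioi hp.RL.le,
    setIntegral_union (Set.Ioc_disjoint_Ioi le_rfl) measurableSet_Ioi (hint.mono_set hsub1)
      (hint.mono_set hsub2), h1, h4, integral_LOS hp ha, integral_NLOS hp ha]
  ring

/-- `GFI` is the radial integral; at the zeros of the antenna gain both vanish. -/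
lemma GFI_eq {p : Params} (hp : Admissible p) {s : ℝ} (hs : 0 < s) (g : ℝ) :
    GFI p s g = 2 / p.RL ^ 2 * radialIntegral p (s * (p.M * fejer p.M g)) := by
  have hM : (0 : ℝ) < p.M := by exact_mod_cast hp.M
  have hR := hp.RL
  unfold GFI
  split_ifs with h
  · simp [h, radialIntegral, fadingLaplace]
  · have hf : 0 < fejer p.M g := (fejer_nonneg _ _).lt_of_ne' h
    rw [radialIntegral_eq hp (by positivity)]
    have h1 : s * (p.M * fejer p.M g) * p.CN = s * p.M * p.CN * fejer p.M g := by ring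
    have h2 : s * (p.M * fejer p.M g) * p.CL = s * p.M * fejer p.M g * p.CL := by ring
    rw [h1, h2]
    field_simp

lemma continuous_GFI {p : Params} (hp : Admissible p) {s : ℝ} (hs : 0 < s) :
    Continuous (GFI p s) := by
  rw [show GFI p s = _ from funext (GFI_eq hp hs)]
  refine continuous_const.mul (continuous_radialIntegral hp (A := s * p.M) ?_ ?_ ?_)
  · have := continuous_fejer hp.M
    fun_prop
  · intro t
    have := fejer_nonneg p.M t
    positivity
  · intro t
    gcongr
    exact mul_le_of_le_one_right (by positivity) (fejer_le_one p.M t)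

lemma integral_angleLaw {p : Params} (hp : Admissible p) (f : ℝ → ℝ) :
    ∫ t, f t ∂angleLaw p = 1 / 2 * ∫ x in (-1 : ℝ)..1, f (x * p.q / p.wl) := by
  have hc : 0 < p.q / p.wl := div_pos hp.q hp.wl
  have h1 := intervalIntegral.mul_integral_comp_mul_right (a := -1) (b := 1) (f := f) (p.q / p.wl)
  rw [neg_one_mul, one_mul, intervalIntegral.integral_of_le (a := -(p.q / p.wl)) (by linarith),
    ← integral_Icc_eq_integral_Ioc] at h1
  rw [angleLaw, ProbabilityTheory.cond, integral_smul_measure, ← h1, Real.volume_Icc]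
  have h2 : (ENNReal.ofReal (p.q / p.wl - -(p.q / p.wl)))⁻¹.toReal = 1 / (2 * (p.q / p.wl)) := by
    rw [ENNReal.toReal_inv, ENNReal.toReal_ofReal (by linarith), sub_neg_eq_add, ← two_mul, one_div]
  rw [h2, smul_eq_mul]
  simp_rw [mul_div_assoc]
  generalize ∫ x in (-1 : ℝ)..1, f (x * (p.q / p.wl)) = J
  have := hp.q.ne'
  have := hp.wl.ne'
  field_simp

/-! ### Gauss–Chebyshev quadrature -/

/-- Convergence of the midpoint Riemann sums of a continuous function. -/
lemma tendsto_midpoint_sum {F : ℝ → ℝ} (hF : Continuous F) {L : ℝ} (hL : 0 < L) :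
    Tendsto (fun n : ℕ => L / n * ∑ k ∈ Finset.range n, F ((k + 1 / 2) * (L / n))) atTop
      (𝓝 (∫ t in (0 : ℝ)..L, F t)) := by
  rw [Metric.tendsto_atTop]
  intro ε hε
  have huc := isCompact_Icc.uniformContinuousOn_of_continuous (hF.continuousOn (s := Set.Icc 0 L))
  rw [Metric.uniformContinuousOn_iff] at huc
  obtain ⟨δ, hδ, huc⟩ := huc (ε / (2 * L)) (by positivity)
  obtain ⟨N, hN⟩ := exists_nat_gt (L / δ)
  have hN0 : 0 < N := by
    have : (0 : ℝ) < N := (div_pos hL hδ).trans hN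
    exact_mod_cast this
  refine ⟨N, fun n hn => ?_⟩
  have hn0 : (0 : ℝ) < n := by exact_mod_cast hN0.trans_le hn
  set η := L / n
  have hη : 0 < η := by positivity
  have hηδ : η < δ := by
    rw [div_lt_iff₀ hn0]
    rw [div_lt_iff₀ hδ] at hN
    have : (N : ℝ) ≤ n := by exact_mod_cast hn
    nlinarith
  have hnη : n * η = L := by simp only [η]; field_simp
  have hsplit : ∫ t in (0 : ℝ)..L, F t =
      ∑ k ∈ Finset.range n, ∫ t in (k * η)..((k + 1 : ℕ) * η), F t := by
    rw [intervalIntegral.sum_integral_adjacent_intervals (a := fun k : ℕ => k * η)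
      fun k _ => hF.intervalIntegrable _ _]
    simp [hnη]
  have hterm : ∀ k ∈ Finset.range n,
      |η * F ((k + 1 / 2) * η) - ∫ t in (k * η)..((k + 1 : ℕ) * η), F t| ≤ ε / (2 * L) * η := by
    intro k hk
    have hk' : ((k + 1 : ℕ) : ℝ) ≤ n := by exact_mod_cast Finset.mem_range.1 hk
    push_cast at hk' ⊢
    have hkL : (k + 1) * η ≤ L := by
      rw [← hnη]
      gcongr
    have hk0 : 0 ≤ k * η := by positivity
    have h1 : η * F ((k + 1 / 2) * η) - ∫ t in (k * η)..((k + 1) * η), F t =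
        ∫ t in (k * η)..((k + 1) * η), (F ((k + 1 / 2) * η) - F t) := by
      rw [intervalIntegral.integral_sub (by simp) (hF.intervalIntegrable _ _),
        intervalIntegral.integral_const, smul_eq_mul]
      ring
    have h2 := intervalIntegral.norm_integral_le_of_norm_le_const (a := k * η) (b := (k + 1) * η)
      (f := fun t => F ((k + 1 / 2) * η) - F t) (C := ε / (2 * L)) ?_
    · rw [h1, ← Real.norm_eq_abs]
      refine h2.trans (le_of_eq ?_)
      rw [show (k + 1) * η - k * η = η by ring, abs_of_pos hη]
    · intro t ht
      rw [Set.uIoc_of_le (by nlinarith)] at ht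
      have hmem : t ∈ Set.Icc 0 L := ⟨by linarith [ht.1], by linarith [ht.2]⟩
      have hmid : (k + 1 / 2) * η ∈ Set.Icc 0 L := ⟨by positivity, by nlinarith⟩
      have := huc _ hmid _ hmem ?_
      · rw [Real.dist_eq] at this
        exact this.le
      · rw [Real.dist_eq, abs_lt]
        constructor <;> nlinarith [ht.1, ht.2]
  rw [Real.dist_eq, hsplit, Finset.mul_sum, ← Finset.sum_sub_distrib]
  calc _ ≤ ∑ k ∈ Finset.range n, ε / (2 * L) * η :=
        (Finset.abs_sum_le_sum_abs _ _).trans (Finset.sum_le_sum hterm)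
    _ = ε / 2 := by
        rw [Finset.sum_const, Finset.card_range, nsmul_eq_mul, mul_left_comm, hnη]
        field_simp
    _ < ε := by linarith

/-- Gauss–Chebyshev quadrature is the midpoint rule after the substitution `x = cos t`. -/
lemma tendsto_gaussChebyshev {f : ℝ → ℝ} (hf : Continuous f) :
    Tendsto (fun n : ℕ => Real.pi / n * ∑ i ∈ Finset.Icc 1 n, f (node n i) * √(1 - node n i ^ 2))
      atTop (𝓝 (∫ x in (-1 : ℝ)..1, f x)) := by
  have hint : ∫ t in (0 : ℝ)..Real.pi, f (Real.cos t) * Real.sin t = ∫ x in (-1 : ℝ)..1, f x := by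
    have h1 := intervalIntegral.integral_comp_mul_deriv (a := 0) (b := Real.pi)
      (fun x _ => Real.hasDerivAt_cos x) (by fun_prop) hf
    rw [Real.cos_zero, Real.cos_pi, intervalIntegral.integral_symm (-1) 1] at h1
    rw [← neg_inj, ← h1, ← intervalIntegral.integral_neg]
    simp
  rw [← hint]
  refine (tendsto_midpoint_sum (F := fun t => f (Real.cos t) * Real.sin t) (by fun_prop)
    Real.pi_pos).congr fun n => ?_
  congr 1
  rw [show Finset.Icc 1 n = Finset.Ico 1 (n + 1) from rfl, Finset.sum_Ico_eq_sum_range,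
    Nat.add_sub_cancel]
  refine Finset.sum_congr rfl fun k hk => ?_
  have hkn : k < n := Finset.mem_range.1 hk
  have hn0 : (0 : ℝ) < n := by exact_mod_cast k.zero_le.trans_lt hkn
  have hkn' : (k : ℝ) + 1 ≤ n := by exact_mod_cast hkn
  have hnode : node n (1 + k) = Real.cos ((k + 1 / 2) * (Real.pi / n)) := by
    unfold node
    congr 1
    push_cast
    field_simp
    ring
  have hsin : 0 ≤ Real.sin ((k + 1 / 2) * (Real.pi / n)) := by
    refine Real.sin_nonneg_of_nonneg_of_le_pi (by positivity) ?_
    rw [mul_div_assoc', div_le_iff₀ hn0]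
    nlinarith [Real.pi_pos]
  rw [hnode, ← Real.sin_sq, Real.sqrt_sq hsin]

end MmWave

end

theorem lemma3 {Ω : Type*} [MeasurableSpace Ω] (P : Measure Ω) [IsProbabilityMeasure P]
    (p : MmWave.Params)
    (hdens : 0 < p.dens) (hRL : 0 < p.RL) (hCL : 0 < p.CL) (hCN : 0 < p.CN)
    (hαL : 0 < p.αL) (hαN : 2 < p.αN) (hNL : 0 < p.NL) (hNN : 0 < p.NN)
    (hM : 1 ≤ p.M) (hq : 0 < p.q) (hwl : 0 < p.wl)
    (ν : Measure MmWave.Plane)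
    (Y X : ℕ → Ω → MmWave.Plane) (gL gN θ : ℕ → ℕ → Ω → ℝ)
    (hnet : MmWave.IsNetwork p P ν Y X gL gN θ)
    (W : Set MmWave.Plane) (hW : MeasurableSet W) (hW0 : volume W ≠ 0) (hWtop : volume W ≠ ∞)
    (s : ℝ) (hs : 0 < s) :
    Tendsto (fun n : ℕ => MmWave.closedForm p s n) atTop
      (𝓝 (MmWave.laplaceInterference p P Y X gL gN θ W s)) := by
  have hp : MmWave.Admissible p := ⟨hdens, hRL, hCL, hCN, hαL, hαN, hNL, hNN, hM, hq, hwl⟩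
  have hplane := MmWave.lintegral_one_sub_linkLaplace hp hs.le
  have hradial : ∀ t, 2 * Real.pi * MmWave.radialIntegral p (s * (p.M * MmWave.fejer p.M t)) =
      Real.pi * p.RL ^ 2 * MmWave.GFI p s t := fun t => by
    rw [MmWave.GFI_eq hp hs]
    field_simp
  have hnonneg : 0 ≤ ∫ t, 2 * Real.pi *
      MmWave.radialIntegral p (s * (p.M * MmWave.fejer p.M t)) ∂MmWave.angleLaw p :=
    integral_nonneg fun t => by
      have h1 := MmWave.fejer_nonneg p.M t
      have h2 := MmWave.radialIntegral_nonneg hp (a := s * (p.M * MmWave.fejer p.M t))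
        (by positivity)
      exact mul_nonneg (by positivity) h2
  rw [hnet.laplaceInterference_eq hM hdens hW hW0 hWtop hs (by rw [hplane]; exact
    ENNReal.ofReal_ne_top), hplane, ENNReal.toReal_ofReal hnonneg]
  simp_rw [hradial]
  rw [integral_const_mul, MmWave.integral_angleLaw hp]
  have hf : Continuous fun x => MmWave.GFI p s (x * p.q / p.wl) :=
    (MmWave.continuous_GFI hp hs).comp (by fun_prop)
  have hquad := (MmWave.tendsto_gaussChebyshev hf).const_mul
    (-(Real.pi * p.dens * p.RL ^ 2 / 2))
  convert! (Real.continuous_exp.tendsto _).comp hquad using 2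
  · rename_i n
    simp only [MmWave.closedForm, Function.comp_apply]
    congr 1
    ring
  · congr 1
    ring
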